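/- Let $n\ge 1$, let $\mathcal X$ be either $\mathbb R^n$ or a cube of $\mathbb R^n$, and let $1\le q<p\le\infty$ and $\alpha\in[0,\infty)$. Here a cube is a product of $n$ bounded intervals (each open, closed or half-open) of the same positive finite length, $|Q|$ is the Lebesgue measure of $Q$, and $\fint_Q g:=|Q|^{-1}\int_Q g\,dx$. All functions are real-valued, and $L^q_{\rm loc}(\mathcal X)$ is the set of measurable $f$ on $\mathcal X$ with $f\mathbf 1_E\in L^q(\mathcal X)$ for every bounded measurable $E\subset\mathcal X$. For a cube $Q$, $x\in Q$ and $f\in L^1(Q)$, let $$|f|_Q:=\fint_Q|f|,\qquad \mathcal M_Q(f)(x):=\sup\Big\{\fint_{Q_*}|f|:\ Q_*\text{ a cube},\ x\in Q_*\subset Q\Big\}\in[0,\infty].$$ For $f\in L^q_{\rm loc}(\mathcal X)$ define, when $p<\infty$, $$\|f\|_{\widetilde{JN}_{(p,q,0)_\alpha}(\mathcal X)}:=\sup\Big\{\sum_i|Q_i|\Big[|Q_i|^{-\alpha}\Big(\fint_{Q_i}\big|f-|f|_{Q_i}\big|^q\Big)^{1/q}\Big]^p\Big\}^{1/p},$$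 $$N_{p,q,\alpha}(f):=\sup\Big\{\sum_i|Q_i|\Big[|Q_i|^{-\alpha}\Big(\fint_{Q_i}\big|f-\mathcal M_{Q_i}(f)\big|^q\Big)^{1/q}\Big]^p\Big\}^{1/p},$$ where both suprema are taken over all collections $\{Q_i\}_i$ of cubes contained in $\mathcal X$ whose interiors are pairwise disjoint; when $p=\infty$, define them respectively by $$\sup_Q|Q|^{-\alpha}\Big(\fint_Q\big|f-|f|_Q\big|^q\Big)^{1/q}\quad\text{and}\quad \sup_Q|Q|^{-\alpha}\Big(\fint_Q\big|f-\mathcal M_Q(f)\big|^q\Big)^{1/q},$$ where $Q$ runs over all cubes contained in $\mathcal X$. Let $\widetilde{JN}_{(p,q,0)_\alpha}(\mathcal X)$ be the set of all $f\in L^q_{\rm loc}(\mathcal X)$ with $\|f\|_{\widetilde{JN}_{(p,q,0)_\alpha}(\mathcal X)}<\infty$. Then $f\in\widetilde{JN}_{(p,q,0)_\alpha}(\mathcal X)$ if and only if $f\in L^q_{\rm loc}(\mathcal X)$ and $N_{p,q,\alpha}(f)<\infty$. Moreover, there is a constant $C\in(0,\infty)$, independent of $f$, such that for every $f\in L^q_{\rm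 loc}(\mathcal X)$ (both quantities taking values in $[0,\infty]$) $$C^{-1}N_{p,q,\alpha}(f)\le\|f\|_{\widetilde{JN}_{(p,q,0)_\alpha}(\mathcal X)}\le C\,N_{p,q,\alpha}(f).$$ -/

import Mathlib

open MeasureTheory Set
open scoped ENNReal NNReal

noncomputable section

namespace JNSpace

/-- A cube of `ℝⁿ`: a product of `n` bounded intervals (each may be open, closed or half-open)
of the same positive length. -/
def IsCube {n : ℕ} (Q : Set (Fin n → ℝ)) : Prop :=
  ∃ (a : Fin n → ℝ) (l : ℝ) (I : Fin n → Set ℝ), 0 < l ∧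
    (∀ i, Ioo (a i) (a i + l) ⊆ I i ∧ I i ⊆ Icc (a i) (a i + l)) ∧
    Q = Set.univ.pi I

/-- `L^q_loc(X)`: (Lebesgue) measurable real functions whose restriction to every bounded
(measurable) subset of `X` belongs to `L^q`.  A function on `X` is represented by a function on
`ℝⁿ`, of which only the values on `X` are used. -/
def MemLqLoc {n : ℕ} (q : ℝ) (X : Set (Fin n → ℝ)) (f : (Fin n → ℝ) → ℝ) : Prop :=
  AEStronglyMeasurable f (volume.restrict X) ∧
    ∀ E : Set (Fin n → ℝ), E ⊆ X → MeasurableSet E → Bornology.IsBounded E →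
      MemLp f (ENNReal.ofReal q) (volume.restrict E)

/-- The normalized `L^q` quantity `(⨍_Q g^q)^(1/q)` of a `[0,∞]`-valued function `g`. -/
def lqMean {n : ℕ} (q : ℝ) (Q : Set (Fin n → ℝ)) (g : (Fin n → ℝ) → ℝ≥0∞) : ℝ≥0∞ :=
  ((volume Q)⁻¹ * ∫⁻ x in Q, g x ^ q) ^ (1 / q)

/-- The local Hardy-Littlewood maximal function `M_Q(f)(x)`, with values in `[0,∞]`: the
supremum of the averages of `|f|` over all cubes `R` with `x ∈ R ⊆ Q`. -/
def localMaximal {n : ℕ} (Q : Set (Fin n → ℝ)) (f : (Fin n → ℝ) → ℝ) (x : Fin n → ℝ) : ℝ≥0∞ :=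
  ⨆ (R : Set (Fin n → ℝ)) (_ : IsCube R ∧ x ∈ R ∧ R ⊆ Q),
    (volume R)⁻¹ * ∫⁻ y in R, ‖f y‖ₑ

/-- `(⨍_Q |f - |f|_Q|^q)^(1/q)`, where `|f|_Q = ⨍_Q |f|`. -/
def absOsc {n : ℕ} (q : ℝ) (f : (Fin n → ℝ) → ℝ) (Q : Set (Fin n → ℝ)) : ℝ≥0∞ :=
  lqMean q Q (fun x => ‖f x - ⨍ y in Q, |f y|‖ₑ)

/-- `(⨍_Q |f - M_Q(f)|^q)^(1/q)`; the difference is taken in the extended reals, so the integrand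
is `∞` where `M_Q(f)` is `∞`. -/
def maxOsc {n : ℕ} (q : ℝ) (f : (Fin n → ℝ) → ℝ) (Q : Set (Fin n → ℝ)) : ℝ≥0∞ :=
  lqMean q Q (fun x => EReal.abs ((f x : EReal) - (localMaximal Q f x : EReal)))

/-- The John-Nirenberg-type supremum of a quantity `A Q` attached to cubes `Q ⊆ X`:
`sup (∑ᵢ |Qᵢ| (|Qᵢ|^(-α) A(Qᵢ))^p)^(1/p)` over all collections of cubes of `X` with pairwise
disjoint interiors if `p < ∞`, and `sup |Q|^(-α) A(Q)` over all cubes `Q` of `X` if `p = ∞`. -/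
def jnSup {n : ℕ} (p : ℝ≥0∞) (α : ℝ) (X : Set (Fin n → ℝ))
    (A : Set (Fin n → ℝ) → ℝ≥0∞) : ℝ≥0∞ :=
  open Classical in
  if p = ∞ then
    ⨆ (Q : Set (Fin n → ℝ)) (_ : IsCube Q ∧ Q ⊆ X), volume Q ^ (-α) * A Q
  else
    ⨆ (C : Set (Set (Fin n → ℝ)))
      (_ : (∀ Q ∈ C, IsCube Q ∧ Q ⊆ X) ∧ C.PairwiseDisjoint interior),
      (∑' Q : C, volume (Q : Set (Fin n → ℝ)) *
        (volume (Q : Set (Fin n → ℝ)) ^ (-α) * A Q) ^ p.toReal) ^ (1 / p.toReal)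

/-- The "norm" of the John-Nirenberg-Campanato-type space with indices `(p, q, 0)_α`. -/
def jnTildeNorm {n : ℕ} (p : ℝ≥0∞) (q α : ℝ) (X : Set (Fin n → ℝ))
    (f : (Fin n → ℝ) → ℝ) : ℝ≥0∞ :=
  jnSup p α X (absOsc q f)

/-- Membership in the John-Nirenberg-Campanato-type space with indices `(p, q, 0)_α`. -/
def MemJNTilde {n : ℕ} (p : ℝ≥0∞) (q α : ℝ) (X : Set (Fin n → ℝ))
    (f : (Fin n → ℝ) → ℝ) : Prop :=
  MemLqLoc q X f ∧ jnTildeNorm p q α X f < ∞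

/-- The John-Nirenberg-type supremum built from `f - M_Q(f)`. -/
def jnMaximalNorm {n : ℕ} (p : ℝ≥0∞) (q α : ℝ) (X : Set (Fin n → ℝ))
    (f : (Fin n → ℝ) → ℝ) : ℝ≥0∞ :=
  jnSup p α X (maxOsc q f)

end JNSpace

end

namespace JNSpace

variable {n : ℕ}

/-! ### Cubes and balls of the supremum norm -/

/-! Both suprema are compared with the one built from the `L^1` oscillation `absOsc 1`. The bridge
is a John–Nirenberg inequality: for `1 ≤ q < p` the supremum of `absOsc q` is at most a constant
times that of `absOsc 1` (`exists_jnSup_absOsc_le`).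

Bounding the norm by the maximal functional: with `c = |f|_Q`, the function `f - c` has nonpositive
integral over `Q`, so `∫|f - c| ≤ 2∫(c - f)⁺`. Since `c ≤ M_Q f` on `Q`, the last integrand is at
most `|f - M_Q f|` (`absOsc_one_le_maxOsc_one`). Jensen and the bridge finish this direction.

Bounding the maximal functional by the norm: choose `s` with `q < s < p`. On `Q` one has `|f - M_Q
f| ≤ |f - c| + M_Q(f - c)`, and `M_Q` is bounded on `L^s` because `s > 1`
(`lintegral_localMaximal_rpow_le`). Hence `maxOsc q ≤ maxOsc s ≲ absOsc s`, and the bridge at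
exponent `s` returns to `absOsc 1 ≤ absOsc q`.

The bridge is proved by iteration. A Calderón–Zygmund stopping of `f - |f|_P` at height `2 * absOsc
1 f P` selects disjoint dyadic subcubes filling at most half of `P`; up to `2^(n+1) * absOsc 1 f P`,
the oscillation on `P` is that on these subcubes (`truncOsc_rpow_le`). If `truncOsc^(1/q) ≤ b
|P|^(1/q-1/p) Φ(P)^(1/p)` on every ball, with `Φ` superadditive, Hölder for sums and the halved
volume improve `b` to `2^(n+1) + θb`, where `θ = 2^(-(1/q-1/p)) < 1` (`truncOsc_iterate`). Iterating
leads to the fixed point `jnConst`. -/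

lemma isCube_ball (c : Fin n → ℝ) {r : ℝ} (hr : 0 < r) : IsCube (Metric.ball c r) := by
  refine ⟨fun i => c i - r, 2 * r, fun i => Metric.ball (c i) r, by positivity, fun i => ?_,
    ball_pi c hr⟩
  simp only [Real.ball_eq_Ioo]
  have : c i - r + 2 * r = c i + r := by ring
  exact ⟨by rw [this], by rw [this]; exact Ioo_subset_Icc_self⟩

lemma IsCube.exists_ball {Q : Set (Fin n → ℝ)} (hQ : IsCube Q) :
    ∃ (c : Fin n → ℝ) (r : ℝ), 0 < r ∧ Metric.ball c r ⊆ Q ∧ Q ⊆ Metric.closedBall c r := by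
  obtain ⟨a, l, I, hl, hI, rfl⟩ := hQ
  refine ⟨fun i => a i + l / 2, l / 2, by positivity, ?_, ?_⟩
  · rw [ball_pi _ (by positivity)]
    refine pi_mono fun i _ => ?_
    rw [Real.ball_eq_Ioo]
    convert (hI i).1 using 2 <;> ring
  · rw [closedBall_pi _ (by positivity)]
    refine pi_mono fun i _ => ?_
    rw [Real.closedBall_eq_Icc]
    convert (hI i).2 using 2 <;> ring

lemma volume_closedBall_eq_ball (c : Fin n → ℝ) {r : ℝ} (hr : 0 < r) :
    volume (Metric.closedBall c r) = volume (Metric.ball c r) := by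
  rw [Real.volume_pi_ball _ hr, Real.volume_pi_closedBall _ hr.le]

lemma volume_ball_ne_zero (c : Fin n → ℝ) {r : ℝ} (hr : 0 < r) :
    volume (Metric.ball c r) ≠ 0 := (Metric.measure_ball_pos _ _ hr).ne'

lemma volume_ball_ne_top (c : Fin n → ℝ) (r : ℝ) :
    volume (Metric.ball c r) ≠ ∞ := measure_ball_lt_top.ne

lemma closedBall_ae_eq_ball (c : Fin n → ℝ) {r : ℝ} (hr : 0 < r) :
    Metric.closedBall c r =ᵐ[volume] Metric.ball c r :=
  (ae_eq_of_subset_of_measure_ge Metric.ball_subset_closedBall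
    (volume_closedBall_eq_ball c hr).le measurableSet_ball.nullMeasurableSet
    measure_closedBall_lt_top.ne).symm

lemma ae_eq_ball_of_subset {Q : Set (Fin n → ℝ)} {c : Fin n → ℝ} {r : ℝ} (hr : 0 < r)
    (h1 : Metric.ball c r ⊆ Q) (h2 : Q ⊆ Metric.closedBall c r) :
    Q =ᵐ[volume] Metric.ball c r :=
  (h2.eventuallyLE.trans (closedBall_ae_eq_ball c hr).le).antisymm h1.eventuallyLE

/-- A cube coincides, up to a null set, with the open ball of the supremum norm that it contains. -/
lemma IsCube.exists_ball_ae_eq {Q : Set (Fin n → ℝ)} (hQ : IsCube Q) :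
    ∃ (c : Fin n → ℝ) (r : ℝ), 0 < r ∧ Metric.ball c r ⊆ Q ∧ Q ⊆ Metric.closedBall c r ∧
      Q =ᵐ[volume] Metric.ball c r := by
  obtain ⟨c, r, hr, h1, h2⟩ := hQ.exists_ball
  exact ⟨c, r, hr, h1, h2, ae_eq_ball_of_subset hr h1 h2⟩

lemma IsCube.volume_ne_zero {Q : Set (Fin n → ℝ)} (hQ : IsCube Q) : volume Q ≠ 0 := by
  obtain ⟨c, r, hr, -, -, h⟩ := hQ.exists_ball_ae_eq
  rw [measure_congr h]
  exact volume_ball_ne_zero c hr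

lemma IsCube.volume_ne_top {Q : Set (Fin n → ℝ)} (hQ : IsCube Q) : volume Q ≠ ∞ := by
  obtain ⟨c, r, hr, -, -, h⟩ := hQ.exists_ball_ae_eq
  rw [measure_congr h]
  exact volume_ball_ne_top c r

lemma IsCube.isBounded {Q : Set (Fin n → ℝ)} (hQ : IsCube Q) : Bornology.IsBounded Q := by
  obtain ⟨c, r, -, -, h⟩ := hQ.exists_ball
  exact Metric.isBounded_closedBall.subset h

lemma IsCube.measurableSet {Q : Set (Fin n → ℝ)} (hQ : IsCube Q) : MeasurableSet Q := by
  obtain ⟨a, l, I, -, hI, rfl⟩ := hQ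
  refine MeasurableSet.univ_pi fun i => ?_
  have h : I i = Ioo (a i) (a i + l) ∪ (I i ∩ {a i, a i + l}) := by
    ext x
    constructor
    · intro hx
      have := (hI i).2 hx
      rcases eq_or_lt_of_le this.1 with h | h
      · exact Or.inr ⟨hx, by simp [h]⟩
      rcases eq_or_lt_of_le this.2 with h' | h'
      · exact Or.inr ⟨hx, by simp [h']⟩
      exact Or.inl ⟨h, h'⟩
    · rintro (hx | hx)
      · exact (hI i).1 hx
      · exact hx.1
  rw [h]
  exact measurableSet_Ioo.union ((Set.toFinite _).inter_of_right _).measurableSet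

/-! ### Normalised `L^q` quantities -/

lemma lqMean_congr_set {q : ℝ} {Q R : Set (Fin n → ℝ)} (h : Q =ᵐ[volume] R)
    (g : (Fin n → ℝ) → ℝ≥0∞) : lqMean q Q g = lqMean q R g := by
  simp only [lqMean, Measure.restrict_congr_set h, measure_congr h]

lemma absOsc_congr_set {q : ℝ} {Q R : Set (Fin n → ℝ)} (h : Q =ᵐ[volume] R)
    (f : (Fin n → ℝ) → ℝ) : absOsc q f Q = absOsc q f R := by
  simp only [absOsc, setAverage_congr h]
  exact lqMean_congr_set h _

/-- Jensen's inequality for normalised `L^q` quantities; `g` need not be measurable. -/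
lemma lqMean_le_lqMean {q s : ℝ} (hq : 0 < q) (hqs : q ≤ s) {Q : Set (Fin n → ℝ)}
    (hQ0 : volume Q ≠ 0) (hQ : volume Q ≠ ∞) (g : (Fin n → ℝ) → ℝ≥0∞) :
    lqMean q Q g ≤ lqMean s Q g := by
  have hs : 0 < s := hq.trans_le hqs
  -- A measurable minorant of `g ^ q` with the same lower integral makes Hölder available without
  -- measurability of `g`.
  obtain ⟨φ, hφm, hφ, hφi⟩ := exists_measurable_le_lintegral_eq (volume.restrict Q) (fun x => g x ^ q)
  set μ : Measure (Fin n → ℝ) := (volume Q)⁻¹ • volume.restrict Q with hμ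
  have : IsProbabilityMeasure μ := ⟨by
    simp [hμ, ENNReal.inv_mul_cancel hQ0 hQ]⟩
  have key := eLpNorm'_le_eLpNorm'_of_exponent_le (f := fun x => φ x ^ (1 / q)) hq hqs μ
    (hφm.pow_const _).aestronglyMeasurable
  simp only [eLpNorm', enorm_eq_self, hμ, lintegral_smul_measure, smul_eq_mul] at key
  have h1 : ∀ x, (φ x ^ (1 / q)) ^ q = φ x := fun x => by
    rw [← ENNReal.rpow_mul, one_div_mul_cancel hq.ne', ENNReal.rpow_one]
  simp only [h1] at key
  rw [lqMean, hφi, lqMean]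
  refine key.trans ?_
  gcongr with x
  calc φ x ^ (1 / q) ≤ (g x ^ q) ^ (1 / q) := by gcongr; exact hφ x
    _ = g x := by rw [← ENNReal.rpow_mul, mul_one_div_cancel hq.ne', ENNReal.rpow_one]

lemma lqMean_one (Q : Set (Fin n → ℝ)) (g : (Fin n → ℝ) → ℝ≥0∞) :
    lqMean 1 Q g = (volume Q)⁻¹ * ∫⁻ x in Q, g x := by
  simp [lqMean]

lemma volume_mul_lqMean_one {Q : Set (Fin n → ℝ)} (hQ0 : volume Q ≠ 0) (hQ : volume Q ≠ ∞)
    (g : (Fin n → ℝ) → ℝ≥0∞) : volume Q * lqMean 1 Q g = ∫⁻ x in Q, g x := by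
  rw [lqMean_one, ← mul_assoc, ENNReal.mul_inv_cancel hQ0 hQ, one_mul]

/-! ### Averages of `|f|` -/

lemma ofReal_setAverage_abs {f : (Fin n → ℝ) → ℝ} {Q : Set (Fin n → ℝ)} (hQ0 : volume Q ≠ 0)
    (hf : IntegrableOn f Q) :
    ENNReal.ofReal (⨍ y in Q, |f y|) = (volume Q)⁻¹ * ∫⁻ y in Q, ‖f y‖ₑ := by
  rw [setAverage_eq, smul_eq_mul, ENNReal.ofReal_mul (by positivity), measureReal_def,
    ← ENNReal.toReal_inv, ENNReal.ofReal_toReal (ENNReal.inv_ne_top.2 hQ0)]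
  congr 1
  exact ofReal_integral_norm_eq_lintegral_enorm hf

lemma setAverage_abs_nonneg (f : (Fin n → ℝ) → ℝ) (Q : Set (Fin n → ℝ)) :
    0 ≤ ⨍ y in Q, |f y| := by
  rw [setAverage_eq, smul_eq_mul]
  exact mul_nonneg (by positivity) (integral_nonneg fun _ => abs_nonneg _)

lemma ofReal_setAverage_abs_le_localMaximal {f : (Fin n → ℝ) → ℝ} {Q : Set (Fin n → ℝ)}
    (hQ : IsCube Q) (hf : IntegrableOn f Q) {x : Fin n → ℝ} (hx : x ∈ Q) :
    ENNReal.ofReal (⨍ y in Q, |f y|) ≤ localMaximal Q f x := by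
  rw [ofReal_setAverage_abs hQ.volume_ne_zero hf]
  exact le_iSup₂_of_le Q ⟨hQ, hx, Subset.rfl⟩ le_rfl

/-- `c` stands for the average and `M` for the maximal function, possibly infinite. Only points with
`a < c` carry information, and there `M` lies even further above `a`. -/
lemma ofReal_sub_le_abs_coe_sub_coe {a c : ℝ} {M : ℝ≥0∞} (h : ENNReal.ofReal c ≤ M) :
    ENNReal.ofReal (c - a) ≤ EReal.abs ((a : EReal) - (M : EReal)) := by
  induction M using ENNReal.recTopCoe with
  | top => simp
  | coe m =>
    have hc : c ≤ m := by
      rw [← ENNReal.ofReal_coe_nnreal] at h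
      exact (ENNReal.ofReal_le_ofReal_iff m.2).1 h
    have : ((m : ℝ≥0∞) : EReal) = ((m : ℝ) : EReal) := rfl
    rw [this, ← EReal.coe_sub, EReal.abs_def, abs_sub_comm]
    exact ENNReal.ofReal_le_ofReal ((sub_le_sub_right hc a).trans (le_abs_self _))

lemma abs_coe_sub_coe_le {a c : ℝ} {M : ℝ≥0∞} (h : ENNReal.ofReal c ≤ M) (hc : 0 ≤ c) :
    EReal.abs ((a : EReal) - (M : EReal)) ≤ ‖a - c‖ₑ + (M - ENNReal.ofReal c) := by
  induction M using ENNReal.recTopCoe with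
  | top => simp
  | coe m =>
    have hcm : c ≤ m := by
      rw [← ENNReal.ofReal_coe_nnreal] at h
      exact (ENNReal.ofReal_le_ofReal_iff m.2).1 h
    have : ((m : ℝ≥0∞) : EReal) = ((m : ℝ) : EReal) := rfl
    rw [this, ← EReal.coe_sub, EReal.abs_def, ← ENNReal.ofReal_coe_nnreal,
      ← ENNReal.ofReal_sub _ hc, Real.enorm_eq_ofReal_abs,
      ← ENNReal.ofReal_add (abs_nonneg _) (by linarith)]
    apply ENNReal.ofReal_le_ofReal
    calc |a - m| = |(a - c) - (m - c)| := by ring_nf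
      _ ≤ |a - c| + |m - c| := abs_sub _ _
      _ = |a - c| + (m - c) := by rw [abs_of_nonneg (by linarith : (0:ℝ) ≤ m - c)]

lemma setIntegral_le_volume_mul_setAverage_abs {f : (Fin n → ℝ) → ℝ} {Q : Set (Fin n → ℝ)}
    (hQ : volume Q ≠ ∞) (hf : IntegrableOn f Q) :
    ∫ x in Q, (f x - ⨍ y in Q, |f y|) ≤ 0 := by
  have hfin : IsFiniteMeasure (volume.restrict Q) := ⟨by simpa using hQ.lt_top⟩
  rw [integral_sub hf (integrable_const _), setIntegral_const, measure_smul_setAverage _ hQ]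
  have : ∫ x in Q, f x ≤ ∫ x in Q, |f x| :=
    integral_mono hf hf.abs fun x => le_abs_self _
  linarith

lemma absOsc_one_le_maxOsc_one {f : (Fin n → ℝ) → ℝ} {Q : Set (Fin n → ℝ)} (hQ : IsCube Q)
    (hf : IntegrableOn f Q) : absOsc 1 f Q ≤ 2 * maxOsc 1 f Q := by
  have hQt := hQ.volume_ne_top
  have hfin : IsFiniteMeasure (volume.restrict Q) := ⟨by simpa using hQt.lt_top⟩
  set c := ⨍ y in Q, |f y| with hc
  have hi : IntegrableOn (fun x => f x - c) Q := hf.sub (integrable_const _)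
  have hi' : IntegrableOn (fun x => max (c - f x) 0) Q :=
    ((integrable_const _).sub hf).pos_part
  have h1 : ∫ x in Q, ‖f x - c‖ ≤ 2 * ∫ x in Q, max (c - f x) 0 := by
    -- The linear term has nonpositive integral, because `c` averages `|f|` rather than `f`.
    have h2 : ∀ x, ‖f x - c‖ = (f x - c) + 2 * max (c - f x) 0 := fun x => by
      rw [Real.norm_eq_abs]
      rcases le_total (f x) c with h | h
      · rw [abs_of_nonpos (by linarith), max_eq_left (by linarith)]; ring
      · rw [abs_of_nonneg (by linarith), max_eq_right (by linarith)]; ring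
    simp only [h2]
    rw [integral_add hi (hi'.const_mul 2), integral_const_mul]
    linarith [setIntegral_le_volume_mul_setAverage_abs hQt hf]
  rw [absOsc, maxOsc, lqMean_one, lqMean_one, mul_left_comm]
  gcongr
  calc ∫⁻ x in Q, ‖f x - c‖ₑ = ENNReal.ofReal (∫ x in Q, ‖f x - c‖) :=
        (ofReal_integral_norm_eq_lintegral_enorm hi).symm
    _ ≤ ENNReal.ofReal (2 * ∫ x in Q, max (c - f x) 0) := ENNReal.ofReal_le_ofReal h1
    _ = 2 * ∫⁻ x in Q, ENNReal.ofReal (max (c - f x) 0) := by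
        rw [ENNReal.ofReal_mul (by norm_num), ofReal_integral_eq_lintegral_ofReal hi'
          (Filter.Eventually.of_forall fun x => le_max_right _ _)]
        simp
    _ ≤ _ := by
        gcongr 2 * ?_
        refine setLIntegral_mono' hQ.measurableSet fun x hx => ?_
        rw [show ENNReal.ofReal (max (c - f x) 0) = ENNReal.ofReal (c - f x) by
          simp]
        exact ofReal_sub_le_abs_coe_sub_coe
          (ofReal_setAverage_abs_le_localMaximal hQ hf hx)

end JNSpace

namespace JNSpace

variable {n : ℕ}

/-! ### Packings of cubes -/

/-- A collection of cubes contained in `X` with pairwise disjoint interiors. -/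
def IsPacking (X : Set (Fin n → ℝ)) (C : Set (Set (Fin n → ℝ))) : Prop :=
  (∀ Q ∈ C, IsCube Q ∧ Q ⊆ X) ∧ C.PairwiseDisjoint interior

/-- The supremum of `∑ᵢ w(Qᵢ)` over all collections of cubes of `X` with pairwise disjoint
interiors. -/
noncomputable def packingSup (w : Set (Fin n → ℝ) → ℝ≥0∞) (X : Set (Fin n → ℝ)) : ℝ≥0∞ :=
  ⨆ (C : Set (Set (Fin n → ℝ))) (_ : IsPacking X C), ∑' Q : C, w Q

lemma tsum_le_packingSup (w : Set (Fin n → ℝ) → ℝ≥0∞) {X : Set (Fin n → ℝ)}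
    {C : Set (Set (Fin n → ℝ))} (hC : IsPacking X C) : ∑' Q : C, w Q ≤ packingSup w X :=
  le_iSup₂_of_le C hC le_rfl

lemma IsPacking.mono {X Y : Set (Fin n → ℝ)} (h : X ⊆ Y) {C : Set (Set (Fin n → ℝ))}
    (hC : IsPacking X C) : IsPacking Y C :=
  ⟨fun Q hQ => ⟨(hC.1 Q hQ).1, (hC.1 Q hQ).2.trans h⟩, hC.2⟩

lemma packingSup_mono_set (w : Set (Fin n → ℝ) → ℝ≥0∞) {X Y : Set (Fin n → ℝ)} (h : X ⊆ Y) :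
    packingSup w X ≤ packingSup w Y :=
  iSup₂_le fun _ hC => tsum_le_packingSup w (hC.mono h)

lemma le_packingSup (w : Set (Fin n → ℝ) → ℝ≥0∞) {X Q : Set (Fin n → ℝ)} (hQ : IsCube Q)
    (hQX : Q ⊆ X) : w Q ≤ packingSup w X := by
  have : IsPacking X {Q} := ⟨by rintro R rfl; exact ⟨hQ, hQX⟩, pairwiseDisjoint_singleton _ _⟩
  refine le_trans ?_ (tsum_le_packingSup w this)
  rw [tsum_singleton]

lemma packingSup_mono {w w' : Set (Fin n → ℝ) → ℝ≥0∞} {X : Set (Fin n → ℝ)}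
    (h : ∀ Q, IsCube Q → Q ⊆ X → w Q ≤ w' Q) : packingSup w X ≤ packingSup w' X :=
  iSup₂_le fun C hC => (ENNReal.tsum_le_tsum fun Q : C => h Q (hC.1 Q Q.2).1 (hC.1 Q Q.2).2).trans
    (tsum_le_packingSup w' hC)

lemma mul_packingSup (a : ℝ≥0∞) (w : Set (Fin n → ℝ) → ℝ≥0∞) (X : Set (Fin n → ℝ)) :
    a * packingSup w X = packingSup (fun Q => a * w Q) X := by
  simp only [packingSup, ENNReal.mul_iSup, ENNReal.tsum_mul_left]

lemma IsCube.interior_nonempty {Q : Set (Fin n → ℝ)} (hQ : IsCube Q) :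
    (interior Q).Nonempty := by
  obtain ⟨c, r, hr, h, -⟩ := hQ.exists_ball
  exact ⟨c, interior_maximal h Metric.isOpen_ball (Metric.mem_ball_self hr)⟩

lemma IsCube.volume_interior {Q : Set (Fin n → ℝ)} (hQ : IsCube Q) :
    volume (interior Q) = volume Q := by
  obtain ⟨c, r, hr, h, -, h2⟩ := hQ.exists_ball_ae_eq
  refine le_antisymm (measure_mono interior_subset) ?_
  rw [measure_congr h2]
  exact measure_mono (interior_maximal h Metric.isOpen_ball)

lemma packingSup_volume_le (X : Set (Fin n → ℝ)) :
    packingSup (fun Q => volume Q) X ≤ volume X := by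
  refine iSup₂_le fun C hC => ?_
  -- Cubes of a packing may share boundary points; only the interiors are disjoint, and they carry
  -- the full volume.
  calc ∑' Q : C, volume (Q : Set (Fin n → ℝ)) = ∑' Q : C, volume (interior (Q : Set (Fin n → ℝ))) :=
        tsum_congr fun Q => (hC.1 Q Q.2).1.volume_interior.symm
    _ ≤ volume (⋃ Q : C, interior (Q : Set (Fin n → ℝ))) :=
        tsum_meas_le_meas_iUnion_of_disjoint _ (fun Q => isOpen_interior.measurableSet)
          fun Q R hQR => hC.2 Q.2 R.2 (Subtype.coe_injective.ne hQR)
    _ ≤ volume X := measure_mono (iUnion_subset fun Q => interior_subset.trans (hC.1 Q Q.2).2)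

lemma exists_packing_lt_tsum_add (w : Set (Fin n → ℝ) → ℝ≥0∞) (X : Set (Fin n → ℝ))
    (hX : packingSup w X ≠ ∞) {ε : ℝ≥0∞} (hε : 0 < ε) :
    ∃ C, IsPacking X C ∧ packingSup w X ≤ ∑' Q : C, w Q + ε := by
  by_cases h0 : packingSup w X = 0
  · exact ⟨∅, ⟨by simp, by simp⟩, by simp [h0]⟩
  · have := ENNReal.sub_lt_self hX h0 hε.ne'
    obtain ⟨C, hC⟩ := lt_iSup_iff.1 this
    obtain ⟨hC', h⟩ := lt_iSup_iff.1 hC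
    exact ⟨C, hC', tsub_le_iff_right.1 h.le⟩

/-- Superadditivity of `packingSup`, for finitely many pieces. -/
lemma sum_packingSup_le (w : Set (Fin n → ℝ) → ℝ≥0∞) {X : Set (Fin n → ℝ)} {ι : Type*}
    (s : Finset ι) (R : ι → Set (Fin n → ℝ)) (hR : ∀ i ∈ s, R i ⊆ X)
    (hd : (s : Set ι).PairwiseDisjoint fun i => interior (R i)) :
    ∑ i ∈ s, packingSup w (R i) ≤ packingSup w X := by
  by_cases hX : packingSup w X = ∞
  · simp [hX]
  refine ENNReal.le_of_forall_pos_le_add fun ε hε _ => ?_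
  obtain ⟨δ, hδ, hδs⟩ := ENNReal.exists_pos_sum_of_countable'
    (ENNReal.coe_ne_zero.2 hε.ne') s
  choose C hC hCs using fun i : s => exists_packing_lt_tsum_add w (R i)
    (ne_top_of_le_ne_top hX (packingSup_mono_set w (hR i i.2))) (hδ i)
  have hU : IsPacking X (⋃ i, C i) := by
    refine ⟨fun Q hQ => ?_, fun Q hQ Q' hQ' hne => ?_⟩
    · obtain ⟨i, hi⟩ := mem_iUnion.1 hQ
      exact ⟨((hC i).1 Q hi).1, ((hC i).1 Q hi).2.trans (hR i i.2)⟩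
    · obtain ⟨i, hi⟩ := mem_iUnion.1 hQ
      obtain ⟨j, hj⟩ := mem_iUnion.1 hQ'
      by_cases hij : i = j
      · subst hij
        exact (hC i).2 hi hj hne
      · exact (hd i.2 j.2 (Subtype.coe_injective.ne hij)).mono
          (interior_mono ((hC i).1 Q hi).2) (interior_mono ((hC j).1 Q' hj).2)
  -- A cube has nonempty interior, so it cannot belong to the packings of two different pieces;
  -- hence no term is lost in the union.
  have hinj : Function.Injective
      (fun x : Σ i, C i => (⟨x.2, mem_iUnion.2 ⟨x.1, x.2.2⟩⟩ : (⋃ i, C i : Set (Set (Fin n → ℝ))))) := by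
    rintro ⟨i, Q, hQ⟩ ⟨j, Q', hQ'⟩ h
    simp only [Subtype.mk.injEq] at h
    subst h
    by_cases hij : i = j
    · subst hij; rfl
    · exfalso
      have := (hd i.2 j.2 (Subtype.coe_injective.ne hij)).mono
          (interior_mono ((hC i).1 Q hQ).2) (interior_mono ((hC j).1 Q hQ').2)
      exact ((hC i).1 Q hQ).1.interior_nonempty.ne_empty (disjoint_self.1 this)
  calc ∑ i ∈ s, packingSup w (R i) = ∑' i : s, packingSup w (R i) := by
        rw [tsum_fintype, ← Finset.sum_coe_sort]
    _ ≤ ∑' i : s, (∑' Q : C i, w Q + δ i) := ENNReal.tsum_le_tsum hCs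
    _ = ∑' x : Σ i, C i, w x.2 + ∑' i, δ i := by rw [ENNReal.tsum_add, ENNReal.tsum_sigma']
    _ ≤ packingSup w X + ε := by
        gcongr
        exact (ENNReal.tsum_comp_le_tsum_of_injective hinj
          (fun Q => w (Q : Set (Fin n → ℝ)))).trans (tsum_le_packingSup w hU)

lemma tsum_packingSup_le (w : Set (Fin n → ℝ) → ℝ≥0∞) {X : Set (Fin n → ℝ)} {ι : Type*}
    (R : ι → Set (Fin n → ℝ)) (hR : ∀ i, R i ⊆ X)
    (hd : Pairwise (Function.onFun Disjoint fun i => interior (R i))) :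
    ∑' i, packingSup w (R i) ≤ packingSup w X := by
  rw [ENNReal.tsum_eq_iSup_sum]
  exact iSup_le fun s => sum_packingSup_le w s R (fun i _ => hR i) fun i _ j _ hij => hd hij

/-- Packings of the members of a packing form together a packing of `X`. This turns a local bound by
a packing supremum into a global one. -/
lemma packingSup_le_of_le_packingSup {v w : Set (Fin n → ℝ) → ℝ≥0∞} {X : Set (Fin n → ℝ)}
    (h : ∀ Q, IsCube Q → Q ⊆ X → v Q ≤ packingSup w Q) : packingSup v X ≤ packingSup w X :=
  iSup₂_le fun C hC => (ENNReal.tsum_le_tsum fun Q : C => h Q (hC.1 Q Q.2).1 (hC.1 Q Q.2).2).trans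
    (tsum_packingSup_le w _ (fun Q => (hC.1 Q Q.2).2)
      fun Q R hQR => hC.2 Q.2 R.2 (Subtype.coe_injective.ne hQR))

/-! ### Expressing `jnSup` through packing suprema -/

lemma iSup_rpow {z : ℝ} (hz : 0 < z) {κ : Sort*} (u : κ → ℝ≥0∞) :
    (⨆ i, u i) ^ z = ⨆ i, u i ^ z :=
  (ENNReal.orderIsoRpow z hz).map_iSup u

lemma jnSup_eq_packingSup {p : ℝ≥0∞} (hp : p ≠ ∞) (hp0 : p ≠ 0) (α : ℝ) (X : Set (Fin n → ℝ))
    (A : Set (Fin n → ℝ) → ℝ≥0∞) :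
    jnSup p α X A =
      (packingSup (fun Q => volume Q * (volume Q ^ (-α) * A Q) ^ p.toReal) X) ^ (1 / p.toReal) := by
  have h : 0 < 1 / p.toReal := one_div_pos.2 (ENNReal.toReal_pos hp0 hp)
  rw [jnSup, if_neg hp, packingSup, iSup_rpow h]
  refine iSup_congr fun C => ?_
  rw [iSup_rpow h]
  rfl

lemma jnSup_mono {p : ℝ≥0∞} (hp0 : p ≠ 0) {α : ℝ} {X : Set (Fin n → ℝ)}
    {A B : Set (Fin n → ℝ) → ℝ≥0∞} (h : ∀ Q, IsCube Q → Q ⊆ X → A Q ≤ B Q) :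
    jnSup p α X A ≤ jnSup p α X B := by
  by_cases hp : p = ∞
  · simp only [jnSup, if_pos hp]
    exact iSup₂_mono fun Q hQ => by gcongr; exact h Q hQ.1 hQ.2
  · rw [jnSup_eq_packingSup hp hp0, jnSup_eq_packingSup hp hp0]
    gcongr
    exact packingSup_mono fun Q hQ hQX => by gcongr; exact h Q hQ hQX

lemma jnSup_const_mul {p : ℝ≥0∞} (hp0 : p ≠ 0) {α : ℝ} {X : Set (Fin n → ℝ)}
    (c : ℝ≥0∞) (A : Set (Fin n → ℝ) → ℝ≥0∞) :
    jnSup p α X (fun Q => c * A Q) = c * jnSup p α X A := by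
  by_cases hp : p = ∞
  · simp only [jnSup, if_pos hp, ENNReal.mul_iSup, mul_left_comm]
  · have hp1 : 0 < p.toReal := ENNReal.toReal_pos hp0 hp
    rw [jnSup_eq_packingSup hp hp0, jnSup_eq_packingSup hp hp0]
    have h : ∀ Q : Set (Fin n → ℝ), volume Q * (volume Q ^ (-α) * (c * A Q)) ^ p.toReal
        = c ^ p.toReal * (volume Q * (volume Q ^ (-α) * A Q) ^ p.toReal) := fun Q => by
      rw [mul_left_comm _ c, ENNReal.mul_rpow_of_nonneg _ _ hp1.le, mul_left_comm]
    simp only [h]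
    rw [← mul_packingSup, ENNReal.mul_rpow_of_nonneg _ _ (by positivity), ← ENNReal.rpow_mul,
      mul_one_div_cancel hp1.ne', ENNReal.rpow_one]

end JNSpace

namespace JNSpace

variable {n : ℕ}

/-! ### Dyadic subcubes and the Calderón–Zygmund stopping construction -/

/-- Centre of the dyadic subcube of generation `k` and index `m` of the cube `ball c r`. -/
noncomputable def dyadicCenter (c : Fin n → ℝ) (r : ℝ) (k : ℕ) (m : Fin n → ℤ) : Fin n → ℝ :=
  fun i => c i - r + 2 * r / 2 ^ k * (m i + 1 / 2)

/-- Open dyadic subcube of generation `k` and index `m` of the cube `ball c r`. -/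
noncomputable def dyadicBall (c : Fin n → ℝ) (r : ℝ) (k : ℕ) (m : Fin n → ℤ) : Set (Fin n → ℝ) :=
  Metric.ball (dyadicCenter c r k m) (r / 2 ^ k)

/-- Index of the half-open dyadic cube of generation `k` that contains `x`. -/
noncomputable def dyadicIndex (c : Fin n → ℝ) (r : ℝ) (k : ℕ) (x : Fin n → ℝ) : Fin n → ℤ :=
  fun i => ⌊(x i - (c i - r)) / (2 * r / 2 ^ k)⌋

variable {c : Fin n → ℝ} {r : ℝ}

lemma dyadicBall_zero_zero : dyadicBall c r 0 0 = Metric.ball c r := by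
  have : dyadicCenter c r 0 0 = c := by
    funext i
    simp only [dyadicCenter, Pi.zero_apply]
    push_cast
    ring
  simp [dyadicBall, this]

lemma mem_dyadicBall (hr : 0 < r) {k : ℕ} {m : Fin n → ℤ} {x : Fin n → ℝ} :
    x ∈ dyadicBall c r k m ↔ ∀ i, |x i - dyadicCenter c r k m i| < r / 2 ^ k := by
  rw [dyadicBall, Metric.mem_ball, dist_pi_lt_iff (by positivity)]
  rfl

lemma dyadicIndex_of_mem (hr : 0 < r) {k : ℕ} {m : Fin n → ℤ} {x : Fin n → ℝ}
    (hx : x ∈ dyadicBall c r k m) : dyadicIndex c r k x = m := by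
  funext i
  have h := abs_lt.1 ((mem_dyadicBall hr).1 hx i)
  have hs : 0 < 2 * r / 2 ^ k := by positivity
  rw [dyadicIndex, Int.floor_eq_iff, le_div_iff₀ hs, div_lt_iff₀ hs]
  simp only [dyadicCenter] at h
  have e : r / 2 ^ k = (2 * r / 2 ^ k) / 2 := by ring
  rw [e] at h
  constructor <;> nlinarith [h.1, h.2]

lemma mem_closedBall_dyadicCenter (hr : 0 < r) (k : ℕ) (x : Fin n → ℝ) :
    x ∈ Metric.closedBall (dyadicCenter c r k (dyadicIndex c r k x)) (r / 2 ^ k) := by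
  rw [Metric.mem_closedBall, dist_pi_le_iff (by positivity)]
  intro i
  have hs : 0 < 2 * r / 2 ^ k := by positivity
  have h1 := Int.floor_le ((x i - (c i - r)) / (2 * r / 2 ^ k))
  have h2 := Int.lt_floor_add_one ((x i - (c i - r)) / (2 * r / 2 ^ k))
  rw [le_div_iff₀ hs] at h1
  rw [div_lt_iff₀ hs] at h2
  have e : r / 2 ^ k = (2 * r / 2 ^ k) / 2 := by ring
  rw [Real.dist_eq, abs_le, e]
  simp only [dyadicCenter, dyadicIndex]
  constructor <;> nlinarith

lemma dyadicBall_succ_subset (hr : 0 < r) (k : ℕ) (m : Fin n → ℤ) :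
    dyadicBall c r (k + 1) m ⊆ dyadicBall c r k (fun i => m i / 2) := by
  intro x hx
  rw [mem_dyadicBall hr] at hx ⊢
  intro i
  have h := abs_lt.1 (hx i)
  have hs : 0 < r / 2 ^ (k + 1) := by positivity
  have hm : (m i : ℝ) = 2 * ((m i / 2 : ℤ) : ℝ) ∨ (m i : ℝ) = 2 * ((m i / 2 : ℤ) : ℝ) + 1 := by
    rcases Int.emod_two_eq_zero_or_one (m i) with h | h
    · left; have : m i = 2 * (m i / 2) := by omega
      exact_mod_cast this
    · right; have : m i = 2 * (m i / 2) + 1 := by omega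
      exact_mod_cast this
  have e1 : 2 * r / 2 ^ (k + 1) = 2 * (r / 2 ^ (k + 1)) := by ring
  have e2 : 2 * r / 2 ^ k = 4 * (r / 2 ^ (k + 1)) := by ring
  have e3 : r / 2 ^ k = 2 * (r / 2 ^ (k + 1)) := by ring
  simp only [dyadicCenter, e1] at h
  simp only [dyadicCenter, e2]
  rw [e3, abs_lt]
  rcases hm with hm | hm <;> rw [hm] at h <;> constructor <;> nlinarith [h.1, h.2]

/-- Nesting: climbing from generation `k` to `j` through parents reaches a cube containing `x`, and
the index of such a cube is determined by `x`. -/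
lemma dyadicBall_subset_of_mem (hr : 0 < r) {j k : ℕ} (hjk : j ≤ k) {x : Fin n → ℝ}
    {m m' : Fin n → ℤ} (hx : x ∈ dyadicBall c r k m) (hx' : x ∈ dyadicBall c r j m') :
    dyadicBall c r k m ⊆ dyadicBall c r j m' := by
  induction k, hjk using Nat.le_induction generalizing m with
  | base => rw [← dyadicIndex_of_mem hr hx, ← dyadicIndex_of_mem hr hx']
  | succ k _ ih =>
    exact (dyadicBall_succ_subset hr k m).trans (ih (dyadicBall_succ_subset hr k m hx))

/-- The dyadic cubes are open, so the countable union of their boundaries must be discarded. -/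
lemma ae_mem_dyadicBall (hr : 0 < r) :
    ∀ᵐ x : Fin n → ℝ, ∀ k, x ∈ dyadicBall c r k (dyadicIndex c r k x) := by
  rw [ae_all_iff]
  intro k
  have h : ∀ᵐ x : Fin n → ℝ, ∀ m : Fin n → ℤ,
      x ∈ Metric.closedBall (dyadicCenter c r k m) (r / 2 ^ k) → x ∈ dyadicBall c r k m := by
    rw [ae_all_iff]
    intro m
    exact (closedBall_ae_eq_ball _ (by positivity)).le
  filter_upwards [h] with x hx
  exact hx _ (mem_closedBall_dyadicCenter hr k x)

lemma volume_dyadicBall_parent (hr : 0 < r) (k : ℕ) (m m' : Fin n → ℤ) :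
    volume (dyadicBall c r k m') = 2 ^ n * volume (dyadicBall c r (k + 1) m) := by
  rw [dyadicBall, dyadicBall, Real.volume_pi_ball _ (by positivity),
    Real.volume_pi_ball _ (by positivity), ← ENNReal.ofReal_ofNat 2, ← ENNReal.ofReal_pow (by norm_num),
    ← ENNReal.ofReal_mul (by positivity), Fintype.card_fin, ← mul_pow]
  congr 2
  ring

/-- Calderón–Zygmund decomposition of `|g|` on the cube `ball c r` at height `t`. -/
lemma exists_stopping_balls (hr : 0 < r) {g : (Fin n → ℝ) → ℝ}
    (hg : IntegrableOn g (Metric.ball c r)) {t : ℝ≥0∞}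
    (ht : ∫⁻ x in Metric.ball c r, ‖g x‖ₑ ≤ t * volume (Metric.ball c r)) :
    ∃ T : Set (ℕ × (Fin n → ℤ)),
      (∀ a ∈ T, dyadicBall c r a.1 a.2 ⊆ Metric.ball c r) ∧
      T.PairwiseDisjoint (fun a => dyadicBall c r a.1 a.2) ∧
      (∀ a ∈ T, t * volume (dyadicBall c r a.1 a.2) < ∫⁻ x in dyadicBall c r a.1 a.2, ‖g x‖ₑ) ∧
      (∀ a ∈ T, ∫⁻ x in dyadicBall c r a.1 a.2, ‖g x‖ₑ ≤
        2 ^ n * t * volume (dyadicBall c r a.1 a.2)) ∧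
      ∀ᵐ x ∂volume.restrict (Metric.ball c r),
        (∃ a ∈ T, x ∈ dyadicBall c r a.1 a.2) ∨ ‖g x‖ₑ ≤ t := by
  set B := dyadicBall c r with hB
  have hne : ∀ k m, (B k m).Nonempty := fun k m => ⟨_, Metric.mem_ball_self (by positivity)⟩
  -- The maximal dyadic cubes with average above `t`: every larger-generation ancestor still has
  -- average at most `t`.
  refine ⟨{a | B a.1 a.2 ⊆ Metric.ball c r ∧ t * volume (B a.1 a.2) < ∫⁻ x in B a.1 a.2, ‖g x‖ₑ ∧
    ∀ j < a.1, ∀ m, B a.1 a.2 ⊆ B j m → ∫⁻ x in B j m, ‖g x‖ₑ ≤ t * volume (B j m)},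
    fun a ha => ha.1, ?_, fun a ha => ha.2.1, ?_, ?_⟩
  · have key : ∀ (k j : ℕ) (m m' : Fin n → ℤ), t * volume (B j m') < ∫⁻ x in B j m', ‖g x‖ₑ →
        (∀ j < k, ∀ m', B k m ⊆ B j m' → ∫⁻ x in B j m', ‖g x‖ₑ ≤ t * volume (B j m')) →
        ∀ x, x ∈ B k m → x ∈ B j m' → k ≤ j := by
      intro k j m m' h1 h2 x hx hx'
      by_contra! hlt
      exact (h2 j hlt m' (dyadicBall_subset_of_mem hr hlt.le hx hx')).not_gt h1
    rintro ⟨k, m⟩ ha ⟨k', m'⟩ ha' hne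
    refine Set.disjoint_left.2 fun x hx hx' => hne ?_
    have h1 := key k k' m m' ha'.2.1 ha.2.2 x hx hx'
    have h2 := key k' k m' m ha.2.1 ha'.2.2 x hx' hx
    obtain rfl : k = k' := le_antisymm h1 h2
    exact Prod.ext rfl ((dyadicIndex_of_mem hr hx).symm.trans (dyadicIndex_of_mem hr hx'))
  · rintro ⟨k, m⟩ ⟨hsub, hlt, hmin⟩
    obtain ⟨y, hy⟩ := hne k m
    rcases k with _ | k
    -- Generation zero is the ball itself, whose average is at most `t` by `ht`, so a stopped cube
    -- always has a parent.
    · exfalso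
      have h0 : y ∈ B 0 0 := by rw [hB, dyadicBall_zero_zero]; exact hsub hy
      have : m = 0 := by rw [← dyadicIndex_of_mem hr hy, ← dyadicIndex_of_mem hr h0]
      subst this
      rw [hB, dyadicBall_zero_zero] at hlt
      exact hlt.not_ge ht
    · have hpar := dyadicBall_succ_subset (c := c) hr k m
      calc ∫⁻ x in B (k + 1) m, ‖g x‖ₑ ≤ ∫⁻ x in B k (fun i => m i / 2), ‖g x‖ₑ :=
            lintegral_mono_set hpar
        _ ≤ t * volume (B k (fun i => m i / 2)) := hmin k (Nat.lt_succ_self k) _ hpar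
        _ = 2 ^ n * t * volume (B (k + 1) m) := by
            rw [hB, volume_dyadicBall_parent hr k m]; ring
  · have hgi :=
      -- Lebesgue differentiation along the dyadic cubes containing `x`, which are balls not centred
      -- at `x`: outside the stopped cubes all these averages are at most `t`.
      ((integrable_indicator_iff measurableSet_ball).2 hg).norm.locallyIntegrable
    have hleb := IsUnifLocDoublingMeasure.ae_tendsto_average volume hgi 1
    rw [ae_restrict_iff' measurableSet_ball]
    filter_upwards [hleb, ae_mem_dyadicBall (c := c) hr] with x hx hxd hxP
    by_contra! hcon
    obtain ⟨hT, hgt⟩ := hcon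
    have hsub : ∀ k, B k (dyadicIndex c r k x) ⊆ Metric.ball c r := fun k => by
      rw [← dyadicBall_zero_zero (c := c)]
      exact dyadicBall_subset_of_mem hr (Nat.zero_le k) (hxd k) (by rwa [dyadicBall_zero_zero])
    have hall : ∀ k, ∫⁻ y in B k (dyadicIndex c r k x), ‖g y‖ₑ ≤
        t * volume (B k (dyadicIndex c r k x)) := by
      intro k
      induction k using Nat.strong_induction_on with
      | _ k ih =>
        by_contra! hk
        refine hT (k, dyadicIndex c r k x) ⟨hsub k, hk, fun j hj m hm => ?_⟩ (hxd k)
        rw [← dyadicIndex_of_mem hr (hm (hxd k))]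
        exact ih j hj
    have hlim := hx (l := Filter.atTop) (fun k : ℕ => dyadicCenter c r k (dyadicIndex c r k x))
      (fun k => r / 2 ^ k) ?_ (Filter.Eventually.of_forall fun k => by
        rw [one_mul]; exact mem_closedBall_dyadicCenter hr k x)
    · have hlim' := ENNReal.tendsto_ofReal hlim
      refine hgt.not_ge ?_
      have e : ENNReal.ofReal ‖(Metric.ball c r).indicator g x‖ = ‖g x‖ₑ := by
        rw [indicator_of_mem hxP, ofReal_norm]
      rw [e] at hlim'
      refine le_of_tendsto hlim' (Filter.Eventually.of_forall fun k => ?_)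
      have hk : 0 < r / 2 ^ k := by positivity
      rw [setAverage_congr (closedBall_ae_eq_ball _ hk)]
      change ENNReal.ofReal (⨍ y in B k (dyadicIndex c r k x), _) ≤ t
      have hm : MeasurableSet (B k (dyadicIndex c r k x)) := measurableSet_ball
      have h0 : volume (B k (dyadicIndex c r k x)) ≠ 0 := volume_ball_ne_zero _ hk
      have h1 : volume (B k (dyadicIndex c r k x)) ≠ ∞ := volume_ball_ne_top _ _
      have h2 : ⨍ y in B k (dyadicIndex c r k x), ‖(Metric.ball c r).indicator g y‖
          = ⨍ y in B k (dyadicIndex c r k x), |g y| := by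
        rw [setAverage_eq, setAverage_eq]
        congr 1
        refine setIntegral_congr_fun hm fun y hy => ?_
        simp only [indicator_of_mem (hsub k hy), Real.norm_eq_abs]
      rw [h2, ofReal_setAverage_abs h0 (hg.mono_set (hsub k))]
      calc _ ≤ (volume (B k (dyadicIndex c r k x)))⁻¹ * (t * volume (B k (dyadicIndex c r k x))) := by
            gcongr; exact hall k
        _ = t := by rw [mul_left_comm, ENNReal.inv_mul_cancel h0 h1, mul_one]
    · refine tendsto_nhdsWithin_iff.2 ⟨?_, Filter.Eventually.of_forall fun k => ?_⟩
      · have := (tendsto_pow_atTop_nhds_zero_of_lt_one (r := (1/2 : ℝ)) (by norm_num) (by norm_num)).const_mul r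
        simpa [div_eq_mul_inv] using this
      · exact mem_Ioi.2 (by positivity)

end JNSpace

namespace JNSpace

variable {n : ℕ} {c : Fin n → ℝ} {r : ℝ} {f : (Fin n → ℝ) → ℝ}

/-! ### The John–Nirenberg inequality -/

/-- `∫_P min(|f - |f|_P|, N)^q`. -/
noncomputable def truncOsc (q : ℝ) (N : ℝ≥0∞) (f : (Fin n → ℝ) → ℝ) (P : Set (Fin n → ℝ)) : ℝ≥0∞ :=
  ∫⁻ x in P, min ‖f x - ⨍ y in P, |f y|‖ₑ N ^ q

/-- For `a ≥ 0`, `||f| - a| ≤ |f - a|`. This is why averages of `|f|` can replace those of `f` in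
the stopping argument. -/
lemma enorm_setAverage_abs_sub_le {R : Set (Fin n → ℝ)}
    (hR : volume R ≠ ∞) (hf : IntegrableOn f R) (a : ℝ) (ha : 0 ≤ a) :
    volume R * ‖(⨍ y in R, |f y|) - a‖ₑ ≤ ∫⁻ x in R, ‖f x - a‖ₑ := by
  have hfin : IsFiniteMeasure (volume.restrict R) := ⟨by simpa using hR.lt_top⟩
  have h1 : (volume.real R) • ((⨍ y in R, |f y|) - a) = ∫ y in R, (|f y| - a) := by
    rw [integral_sub hf.abs (integrable_const _), setIntegral_const, smul_sub,
      measure_smul_setAverage _ hR]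
  have h2 : volume R * ‖(⨍ y in R, |f y|) - a‖ₑ = ‖(volume.real R) • ((⨍ y in R, |f y|) - a)‖ₑ := by
    rw [enorm_smul, Real.enorm_eq_ofReal measureReal_nonneg, measureReal_def,
      ENNReal.ofReal_toReal hR]
  rw [h2, h1]
  refine (enorm_integral_le_lintegral_enorm _).trans (lintegral_mono fun x => ?_)
  rw [Real.enorm_eq_ofReal_abs, Real.enorm_eq_ofReal_abs]
  refine ENNReal.ofReal_le_ofReal ?_
  have := abs_abs_sub_abs_le (f x) a
  rwa [abs_of_nonneg ha] at this

lemma truncOsc_rpow_le {q : ℝ} (hq : 1 ≤ q) (N : ℝ≥0∞) (hr : 0 < r)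
    (hf : IntegrableOn f (Metric.ball c r)) :
    ∃ T : Set (ℕ × (Fin n → ℤ)),
      (∀ a ∈ T, dyadicBall c r a.1 a.2 ⊆ Metric.ball c r) ∧
      T.PairwiseDisjoint (fun a => dyadicBall c r a.1 a.2) ∧
      2 * ∑' a : T, volume (dyadicBall c r a.1.1 a.1.2) ≤ volume (Metric.ball c r) ∧
      truncOsc q N f (Metric.ball c r) ^ (1 / q) ≤
        2 ^ (n + 1) * (absOsc 1 f (Metric.ball c r) * volume (Metric.ball c r) ^ (1 / q)) +
        (∑' a : T, truncOsc q N f (dyadicBall c r a.1.1 a.1.2)) ^ (1 / q) := by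
  have hq0 : 0 < q := by linarith
  set P := Metric.ball c r with hP
  have hP0 : volume P ≠ 0 := volume_ball_ne_zero c hr
  have hPt : volume P ≠ ∞ := volume_ball_ne_top c r
  have hfin : IsFiniteMeasure (volume.restrict P) := ⟨by simpa using hPt.lt_top⟩
  set cP := ⨍ y in P, |f y| with hcP
  have hcP0 : 0 ≤ cP := setAverage_abs_nonneg f P
  set a := absOsc 1 f P with ha
  have hi : IntegrableOn (fun x => f x - cP) P := hf.sub (integrable_const _)
  have hint : ∫⁻ x in P, ‖f x - cP‖ₑ = a * volume P := by
    rw [mul_comm, ha, absOsc, volume_mul_lqMean_one hP0 hPt]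
  have hat : a ≠ ∞ := by
    intro h
    have : ∫⁻ x in P, ‖f x - cP‖ₑ < ∞ := hi.2
    rw [hint, h, ENNReal.top_mul hP0] at this
    exact this.ne rfl
  obtain ⟨T, hTs, hTd, hTl, hTu, hTc⟩ := exists_stopping_balls hr hi (t := 2 * a) (by
    rw [hint, two_mul, add_mul]; exact le_self_add)
  set B : T → Set (Fin n → ℝ) := fun b => dyadicBall c r b.1.1 b.1.2 with hB
  have hBm : ∀ b, MeasurableSet (B b) := fun b => measurableSet_ball
  have hBP : ∀ b, B b ⊆ P := fun b => hTs b b.2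
  have hBd : Pairwise (Function.onFun Disjoint B) := fun b b' h =>
    hTd b.2 b'.2 (Subtype.coe_injective.ne h)
  have hB0 : ∀ b, volume (B b) ≠ 0 := fun b => volume_ball_ne_zero _ (by positivity)
  have hBt : ∀ b, volume (B b) ≠ ∞ := fun b => volume_ball_ne_top _ _
  refine ⟨T, hTs, hTd, ?_, ?_⟩
  · have h1 : a * (2 * ∑' b, volume (B b)) ≤ a * volume P := by
      rw [← hint, ← mul_assoc, mul_comm a 2, ← ENNReal.tsum_mul_left]
      calc ∑' b, 2 * a * volume (B b) ≤ ∑' b, ∫⁻ x in B b, ‖f x - cP‖ₑ :=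
            ENNReal.tsum_le_tsum fun b => (hTl b b.2).le
        _ = ∫⁻ x in ⋃ b, B b, ‖f x - cP‖ₑ := (lintegral_iUnion hBm hBd _).symm
        _ ≤ _ := lintegral_mono_set (iUnion_subset hBP)
    -- If `a = 0` it cannot be cancelled, but then the strict stopping inequality admits no cube.
    by_cases ha0 : a = 0
    · have : IsEmpty T := ⟨fun b => by
        have h2 := hTl b b.2
        have h3 : ∫⁻ x in B b, ‖f x - cP‖ₑ ≤ 0 :=
          (lintegral_mono_set (hBP b)).trans (by rw [hint, ha0, zero_mul])
        exact absurd h2 (not_lt.2 (h3.trans zero_le))⟩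
      simp
    · exact (ENNReal.mul_le_mul_iff_right ha0 hat).1 h1
  · set κ : ℝ≥0∞ := 2 ^ (n + 1) * a with hκ
    set u : T → (Fin n → ℝ) → ℝ≥0∞ := fun b x => min ‖f x - ⨍ y in B b, |f y|‖ₑ N with hu
    -- The truncated oscillations of the stopped cubes, glued together; by disjointness `∫ h^q` is
    -- the sum of the `truncOsc`.
    set h : (Fin n → ℝ) → ℝ≥0∞ := fun x => ∑' b, (B b).indicator (u b) x with hh
    have hum : ∀ b, AEMeasurable (u b) (volume.restrict P) := fun b =>
      (hf.1.aemeasurable.sub_const _).enorm.min aemeasurable_const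
    have hhm : AEMeasurable h (volume.restrict P) :=
      AEMeasurable.tsum fun b => (hum b).indicator (hBm b)
    have hon : ∀ b x, x ∈ B b → ∀ v : T → (Fin n → ℝ) → ℝ≥0∞,
        ∑' b, (B b).indicator (v b) x = v b x := by
      intro b x hx v
      rw [tsum_eq_single b, indicator_of_mem hx]
      intro b' hb'
      exact indicator_of_notMem (fun hx' => Set.disjoint_left.1 (hBd hb') hx' hx) _
    have hle : ∀ᵐ x ∂volume.restrict P, min ‖f x - cP‖ₑ N ^ q ≤ ((fun _ => κ : (Fin n → ℝ) → ℝ≥0∞) + h) x ^ q := by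
      filter_upwards [hTc] with x hx
      gcongr
      rw [Pi.add_apply]
      rcases hx with ⟨b, hb, hx⟩ | hx
      · rw [hh]
        simp only
        rw [hon ⟨b, hb⟩ x hx]
        set cR := ⨍ y in B ⟨b, hb⟩, |f y| with hcR
        have h1 : ‖cR - cP‖ₑ ≤ κ := by
          have h2 := (enorm_setAverage_abs_sub_le (hBt ⟨b, hb⟩)
            (hf.mono_set (hBP _)) cP hcP0).trans (hTu b hb)
          rw [mul_comm _ (volume _)] at h2
          have h3 := (ENNReal.mul_le_mul_iff_right (hB0 ⟨b, hb⟩) (hBt ⟨b, hb⟩)).1 h2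
          rw [hκ, pow_succ, mul_assoc]
          exact h3
        have h2 : ‖f x - cP‖ₑ ≤ κ + ‖f x - cR‖ₑ := by
          rw [show f x - cP = (cR - cP) + (f x - cR) by ring]
          exact (enorm_add_le _ _).trans (by gcongr)
        change min ‖f x - cP‖ₑ N ≤ κ + min ‖f x - cR‖ₑ N
        rw [← min_add_add_left]
        exact min_le_min h2 le_add_self
      · refine (min_le_left _ _).trans (hx.trans ?_)
        refine le_trans ?_ le_self_add
        rw [hκ, pow_succ, mul_assoc]
        exact le_mul_of_one_le_left zero_le (one_le_pow₀ (by norm_num))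
    have hhq : ∀ x, h x ^ q = ∑' b, (B b).indicator (fun x => u b x ^ q) x := by
      intro x
      by_cases hx : ∃ b, x ∈ B b
      · obtain ⟨b, hb⟩ := hx
        rw [hh]
        simp only
        rw [hon b x hb, hon b x hb (fun b x => u b x ^ q)]
      · push Not at hx
        simp [hh, hx, hq0]
    have hsum : ∫⁻ x in P, h x ^ q = ∑' b, truncOsc q N f (B b) := by
      simp only [hhq]
      rw [lintegral_tsum fun b => ((hum b).pow_const q).indicator (hBm b)]
      refine tsum_congr fun b => ?_
      rw [lintegral_indicator (hBm b), Measure.restrict_restrict (hBm b),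
        inter_eq_left.2 (hBP b), truncOsc]
    calc truncOsc q N f P ^ (1 / q) ≤ (∫⁻ x in P, ((fun _ => κ : (Fin n → ℝ) → ℝ≥0∞) + h) x ^ q) ^ (1 / q) := by
          gcongr ?_ ^ (1 / q)
          exact lintegral_mono_ae hle
      -- Minkowski keeps coefficient one on the second term; a larger factor could destroy the gain
      -- in the iteration.
      _ ≤ (∫⁻ x in P, κ ^ q) ^ (1 / q) + (∫⁻ x in P, h x ^ q) ^ (1 / q) :=
          ENNReal.lintegral_Lp_add_le aemeasurable_const hhm hq
      _ = _ := by
          rw [hsum, setLIntegral_const, ENNReal.mul_rpow_of_nonneg _ _ (by positivity),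
            ← ENNReal.rpow_mul, mul_one_div_cancel hq0.ne', ENNReal.rpow_one, hκ, mul_assoc]

/-- Hölder's inequality for sums. -/
lemma tsum_mul_rpow_le {ι : Type*} (u v : ι → ℝ≥0∞) {s t : ℝ} (hs : 0 ≤ s) (ht : 0 ≤ t)
    (hst : s + t = 1) : ∑' i, u i ^ s * v i ^ t ≤ (∑' i, u i) ^ s * (∑' i, v i) ^ t := by
  let _ : MeasurableSpace ι := ⊤
  have := ENNReal.lintegral_mul_norm_pow_le (μ := Measure.count) (f := u) (g := v)
    (measurable_from_top).aemeasurable (measurable_from_top).aemeasurable hs ht hst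
  simpa only [lintegral_count] using this

/-- Weight of the packing functional controlling the John–Nirenberg inequality. -/
noncomputable def oscWeight (p : ℝ) (f : (Fin n → ℝ) → ℝ) (Q : Set (Fin n → ℝ)) : ℝ≥0∞ :=
  volume Q * absOsc 1 f Q ^ p

/-- The packing functional of `oscWeight`, perturbed by `ε |P|`. -/
noncomputable def perturbedSup (p : ℝ) (ε : ℝ≥0∞) (f : (Fin n → ℝ) → ℝ) (P : Set (Fin n → ℝ)) :
    ℝ≥0∞ :=
  packingSup (oscWeight p f) P + ε * volume P

/-- The gain in the John–Nirenberg iteration. -/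
noncomputable def iterGain (q p : ℝ) : ℝ≥0∞ := 2⁻¹ ^ (1 / q - 1 / p)

/-- Hölder with exponents `1 - q/p` and `q/p` splits the sum over stopped cubes into total volume,
at most half of `|P|`, and total `perturbedSup`, controlled by superadditivity. -/
lemma truncOsc_iterate {q p : ℝ} (hq : 1 ≤ q) (hqp : q < p) (N ε b : ℝ≥0∞)
    {P₀ : Set (Fin n → ℝ)} (hf : IntegrableOn f P₀)
    (hb : ∀ (c : Fin n → ℝ) (r : ℝ), 0 < r → Metric.ball c r ⊆ P₀ →
      truncOsc q N f (Metric.ball c r) ^ (1 / q) ≤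
        b * (volume (Metric.ball c r) ^ (1 / q - 1 / p) *
          perturbedSup p ε f (Metric.ball c r) ^ (1 / p)))
    (hr : 0 < r) (hP : Metric.ball c r ⊆ P₀) :
    truncOsc q N f (Metric.ball c r) ^ (1 / q) ≤
      (2 ^ (n + 1) + iterGain q p * b) * (volume (Metric.ball c r) ^ (1 / q - 1 / p) *
          perturbedSup p ε f (Metric.ball c r) ^ (1 / p)) := by
  have hq0 : 0 < q := by linarith
  have hp0 : 0 < p := by linarith
  have hd : 0 ≤ 1 / q - 1 / p := sub_nonneg.2 (one_div_le_one_div_of_le hq0 hqp.le)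
  have hqp1 : q / p ≤ 1 := (div_le_one hp0).2 hqp.le
  obtain ⟨T, hTs, hTd, hTv, hT⟩ := truncOsc_rpow_le hq N hr (hf.mono_set hP)
  set P := Metric.ball c r with hPdef
  have hP0 : volume P ≠ 0 := volume_ball_ne_zero c hr
  have hPt : volume P ≠ ∞ := volume_ball_ne_top c r
  set B : T → Set (Fin n → ℝ) := fun b => dyadicBall c r b.1.1 b.1.2 with hB
  have hBP : ∀ b, B b ⊆ P := fun b => hTs b b.2
  have hBd : Pairwise (Function.onFun Disjoint B) := fun b b' h =>
    hTd b.2 b'.2 (Subtype.coe_injective.ne h)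
  have hTv' : ∑' a, volume (B a) ≤ 2⁻¹ * volume P := by
    rw [← ENNReal.mul_le_mul_iff_right (a := 2) (by norm_num) (by norm_num), ← mul_assoc,
      ENNReal.mul_inv_cancel (by norm_num) (by norm_num), one_mul]
    exact hTv
  have hsup : ∑' a, perturbedSup p ε f (B a) ≤ perturbedSup p ε f P := by
    simp only [perturbedSup]
    rw [ENNReal.tsum_add, ENNReal.tsum_mul_left]
    gcongr
    · exact tsum_packingSup_le _ B hBP fun b b' h =>
        (hBd h).mono interior_subset interior_subset
    · refine hTv'.trans ?_
      exact mul_le_of_le_one_left zero_le (by simp)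
  have hosc : absOsc 1 f P * volume P ^ (1 / q) ≤
      volume P ^ (1 / q - 1 / p) * perturbedSup p ε f P ^ (1 / p) := by
    have h1 : oscWeight p f P ≤ perturbedSup p ε f P :=
      (le_packingSup _ (isCube_ball c hr) Subset.rfl).trans le_self_add
    calc absOsc 1 f P * volume P ^ (1 / q)
        = volume P ^ (1 / q - 1 / p) * oscWeight p f P ^ (1 / p) := by
          rw [oscWeight, ENNReal.mul_rpow_of_nonneg _ _ (by positivity), ← ENNReal.rpow_mul,
            mul_one_div_cancel hp0.ne', ENNReal.rpow_one, ← mul_assoc,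
            ← ENNReal.rpow_add _ _ hP0 hPt, sub_add_cancel, mul_comm]
      _ ≤ _ := by gcongr
  have hsum : (∑' a, truncOsc q N f (B a)) ^ (1 / q) ≤
      iterGain q p * b * (volume P ^ (1 / q - 1 / p) * perturbedSup p ε f P ^ (1 / p)) := by
    have h1 : ∀ a, truncOsc q N f (B a) ≤
        b ^ q * (volume (B a) ^ (1 - q / p) * perturbedSup p ε f (B a) ^ (q / p)) := by
      intro a
      have h2 := ENNReal.rpow_le_rpow (hb _ (r / 2 ^ a.1.1) (by positivity) ((hBP a).trans hP)) hq0.le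
      rw [← ENNReal.rpow_mul, one_div_mul_cancel hq0.ne', ENNReal.rpow_one,
        ENNReal.mul_rpow_of_nonneg _ _ hq0.le, ENNReal.mul_rpow_of_nonneg _ _ hq0.le,
        ← ENNReal.rpow_mul, ← ENNReal.rpow_mul] at h2
      rw [show (1 / q - 1 / p) * q = 1 - q / p by field_simp,
        show 1 / p * q = q / p by field_simp] at h2
      exact h2
    calc (∑' a, truncOsc q N f (B a)) ^ (1 / q)
        ≤ (b ^ q * ((2⁻¹ * volume P) ^ (1 - q / p) * perturbedSup p ε f P ^ (q / p))) ^ (1 / q) := by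
          gcongr ?_ ^ (1 / q)
          refine (ENNReal.tsum_le_tsum h1).trans ?_
          rw [ENNReal.tsum_mul_left]
          gcongr b ^ q * ?_
          refine (tsum_mul_rpow_le _ _ (by linarith) (by positivity) (by ring)).trans ?_
          have : 0 ≤ 1 - q / p := by linarith
          gcongr
      _ = iterGain q p * b * (volume P ^ (1 / q - 1 / p) * perturbedSup p ε f P ^ (1 / p)) := by
          have e1 : (1 - q / p) * (1 / q) = 1 / q - 1 / p := by field_simp
          have e2 : q / p * (1 / q) = 1 / p := by field_simp
          rw [ENNReal.mul_rpow_of_nonneg _ _ (by positivity),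
            ENNReal.mul_rpow_of_nonneg _ _ (by positivity), ← ENNReal.rpow_mul,
            ← ENNReal.rpow_mul, ← ENNReal.rpow_mul, e1, e2, mul_one_div_cancel hq0.ne',
            ENNReal.rpow_one, ENNReal.mul_rpow_of_nonneg _ _ hd, iterGain]
          ring
  calc _ ≤ _ := hT
    _ ≤ _ := by
      rw [add_mul]
      gcongr

end JNSpace

/-! ### Closing the iteration and removing the truncation -/

namespace JNSpace

variable {n : ℕ} {c : Fin n → ℝ} {r : ℝ} {f : (Fin n → ℝ) → ℝ}

/-- Constant of the John–Nirenberg inequality. -/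
noncomputable def jnConst (n : ℕ) (q p : ℝ) : ℝ≥0∞ := 2 ^ (n + 1) / (1 - iterGain q p)

lemma iterGain_lt_one {q p : ℝ} (hq : 0 < q) (hqp : q < p) : iterGain q p < 1 :=
  ENNReal.rpow_lt_one (by simp) (sub_pos.2 (one_div_lt_one_div_of_lt hq hqp))

lemma jnConst_ne_top {q p : ℝ} (hq : 0 < q) (hqp : q < p) : jnConst n q p ≠ ∞ :=
  ENNReal.div_ne_top (by finiteness) (tsub_pos_iff_lt.2 (iterGain_lt_one hq hqp)).ne'

lemma jnConst_ne_zero (q p : ℝ) : jnConst n q p ≠ 0 :=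
  (ENNReal.div_pos (by simp) (ne_top_of_le_ne_top ENNReal.one_ne_top tsub_le_self)).ne'

lemma two_pow_add_iterGain_mul {q p : ℝ} (hq : 0 < q) (hqp : q < p) :
    2 ^ (n + 1) + iterGain q p * jnConst n q p = jnConst n q p := by
  have h1 := iterGain_lt_one hq hqp
  have h2 : (1 - iterGain q p) * jnConst n q p = 2 ^ (n + 1) :=
    ENNReal.mul_div_cancel (tsub_pos_iff_lt.2 h1).ne'
      (ne_top_of_le_ne_top ENNReal.one_ne_top tsub_le_self)
  rw [← h2, ← add_mul, tsub_add_cancel_of_le h1.le, one_mul]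

lemma truncOsc_rpow_le_perturbedSup {q p : ℝ} (hq : 1 ≤ q) (hqp : q < p) {N ε : ℝ≥0∞}
    (hN : N ≠ ∞) (hε0 : ε ≠ 0) (hε : ε ≠ ∞) {P₀ : Set (Fin n → ℝ)} (hf : IntegrableOn f P₀)
    (hr : 0 < r) (hP : Metric.ball c r ⊆ P₀) :
    truncOsc q N f (Metric.ball c r) ^ (1 / q) ≤
      jnConst n q p * (volume (Metric.ball c r) ^ (1 / q - 1 / p) *
          perturbedSup p ε f (Metric.ball c r) ^ (1 / p)) := by
  have hq0 : 0 < q := by linarith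
  have hp0 : 0 < p := by linarith
  -- A finite starting constant: truncation gives `truncOsc ≤ N^q |P|`, and the perturbation gives
  -- `perturbedSup ≥ ε |P|`.
  set b₀ : ℝ≥0∞ := N * ε ^ (-(1 / p)) with hb₀
  have hb₀t : b₀ ≠ ∞ := ENNReal.mul_ne_top hN (ENNReal.rpow_ne_top_of_ne_zero hε0 hε)
  have key : ∀ k : ℕ, ∀ (c : Fin n → ℝ) (r : ℝ), 0 < r → Metric.ball c r ⊆ P₀ →
      truncOsc q N f (Metric.ball c r) ^ (1 / q) ≤
        (jnConst n q p + iterGain q p ^ k * b₀) * (volume (Metric.ball c r) ^ (1 / q - 1 / p) *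
          perturbedSup p ε f (Metric.ball c r) ^ (1 / p)) := by
    intro k
    induction k with
    | zero =>
      intro c r hr _
      set P := Metric.ball c r with hP
      have hP0 : volume P ≠ 0 := volume_ball_ne_zero c hr
      have hPt : volume P ≠ ∞ := volume_ball_ne_top c r
      calc truncOsc q N f P ^ (1 / q) ≤ (N ^ q * volume P) ^ (1 / q) := by
            gcongr
            rw [truncOsc, ← setLIntegral_const]
            exact lintegral_mono fun x => by gcongr; exact min_le_right _ _
        _ = N * volume P ^ (1 / q) := by
            rw [ENNReal.mul_rpow_of_nonneg _ _ (by positivity), ← ENNReal.rpow_mul,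
              mul_one_div_cancel hq0.ne', ENNReal.rpow_one]
        _ = b₀ * (volume P ^ (1 / q - 1 / p) * (ε * volume P) ^ (1 / p)) := by
            rw [ENNReal.mul_rpow_of_nonneg _ _ (by positivity), hb₀,
              mul_left_comm (volume P ^ (1 / q - 1 / p)), ← ENNReal.rpow_add _ _ hP0 hPt,
              sub_add_cancel, mul_assoc, ← mul_assoc (ε ^ _), ← ENNReal.rpow_add _ _ hε0 hε]
            simp
        _ ≤ _ := by
            gcongr
            · simp
            · rw [perturbedSup]; exact le_add_self
    | succ k ih =>
      intro c r hr hP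
      refine (truncOsc_iterate hq hqp N ε _ hf ih hr hP).trans (le_of_eq ?_)
      rw [mul_add, ← add_assoc, two_pow_add_iterGain_mul hq0 hqp, pow_succ]
      ring
  set W := volume (Metric.ball c r) ^ (1 / q - 1 / p) *
          perturbedSup p ε f (Metric.ball c r) ^ (1 / p) with hW
  by_cases hWt : W = ∞
  · rw [hWt, ENNReal.mul_top (jnConst_ne_zero q p)]; exact le_top
  have hlim : Filter.Tendsto (fun k : ℕ => (jnConst n q p + iterGain q p ^ k * b₀) * W) Filter.atTop
      (nhds ((jnConst n q p + 0 * b₀) * W)) := by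
    refine ENNReal.Tendsto.mul_const ?_ (Or.inr hWt)
    exact tendsto_const_nhds.add (ENNReal.Tendsto.mul_const
      (ENNReal.tendsto_pow_atTop_nhds_zero_of_lt_one (iterGain_lt_one hq0 hqp)) (Or.inr hb₀t))
  rw [zero_mul, add_zero] at hlim
  exact ge_of_tendsto' hlim fun k => key k c r hr hP

lemma truncOsc_rpow_le_packingSup {q p : ℝ} (hq : 1 ≤ q) (hqp : q < p) {N : ℝ≥0∞}
    (hN : N ≠ ∞) (hr : 0 < r) (hf : IntegrableOn f (Metric.ball c r)) :
    truncOsc q N f (Metric.ball c r) ^ (1 / q) ≤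
      jnConst n q p * (volume (Metric.ball c r) ^ (1 / q - 1 / p) *
          packingSup (oscWeight p f) (Metric.ball c r) ^ (1 / p)) := by
  have hq0 : 0 < q := by linarith
  set P := Metric.ball c r with hP
  have hPt : volume P ≠ ∞ := volume_ball_ne_top c r
  have hK : volume P ^ (1 / q - 1 / p) ≠ ∞ :=
    ENNReal.rpow_ne_top_of_ne_zero (volume_ball_ne_zero c hr) hPt
  have hε : Filter.Tendsto (fun k : ℕ => perturbedSup p (k : ℝ≥0∞)⁻¹ f P) Filter.atTop
      (nhds (packingSup (oscWeight p f) P + 0 * volume P)) :=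
    tendsto_const_nhds.add (ENNReal.Tendsto.mul_const ENNReal.tendsto_inv_nat_nhds_zero
      (Or.inr hPt))
  rw [zero_mul, add_zero] at hε
  have hlim := ENNReal.Tendsto.const_mul (a := jnConst n q p)
    (ENNReal.Tendsto.const_mul (a := volume P ^ (1 / q - 1 / p))
      (hε.ennrpow_const (1 / p)) (Or.inr hK)) (Or.inr (jnConst_ne_top hq0 hqp))
  refine ge_of_tendsto hlim ?_
  filter_upwards [Filter.eventually_gt_atTop 0] with k hk
  exact truncOsc_rpow_le_perturbedSup hq hqp hN (by simp) (by simpa using hk.ne') hf hr Subset.rfl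

/-- The John–Nirenberg inequality on balls of the supremum norm. -/
lemma absOsc_ball_le {q p : ℝ} (hq : 1 ≤ q) (hqp : q < p) (hr : 0 < r)
    (hf : IntegrableOn f (Metric.ball c r)) :
    absOsc q f (Metric.ball c r) ≤
      jnConst n q p * (volume (Metric.ball c r) ^ (-(1 / p)) *
          packingSup (oscWeight p f) (Metric.ball c r) ^ (1 / p)) := by
  have hq0 : 0 < q := by linarith
  set P := Metric.ball c r with hP
  have hP0 : volume P ≠ 0 := volume_ball_ne_zero c hr
  have hPt : volume P ≠ ∞ := volume_ball_ne_top c r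
  have hm : AEMeasurable (fun x => ‖f x - ⨍ y in P, |f y|‖ₑ) (volume.restrict P) :=
    (hf.1.aemeasurable.sub_const _).enorm
  have hlim : Filter.Tendsto (fun N : ℕ => truncOsc q N f P) Filter.atTop
      (nhds (∫⁻ x in P, ‖f x - ⨍ y in P, |f y|‖ₑ ^ q)) := by
    refine lintegral_tendsto_of_tendsto_of_monotone
      (fun N => (hm.min aemeasurable_const).pow_const q)
      (Filter.Eventually.of_forall fun x N M h => ?_) (Filter.Eventually.of_forall fun x => ?_)
    · dsimp only; gcongr
    · have h1 := (tendsto_const_nhds (x := ‖f x - ⨍ y in P, |f y|‖ₑ)).min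
        ENNReal.tendsto_nat_nhds_top
      rw [min_top_right] at h1
      exact h1.ennrpow_const q
  have h := le_of_tendsto' (hlim.ennrpow_const (1 / q)) fun N =>
    truncOsc_rpow_le_packingSup hq hqp (ENNReal.natCast_ne_top N) hr hf
  rw [absOsc, lqMean, ENNReal.mul_rpow_of_nonneg _ _ (by positivity)]
  refine (mul_le_mul' le_rfl h).trans (le_of_eq ?_)
  rw [mul_left_comm, ← mul_assoc (_ ^ (1 / q)), ← ENNReal.rpow_neg_one, ← ENNReal.rpow_mul,
    ← ENNReal.rpow_add _ _ hP0 hPt]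
  congr 3
  ring_nf

/-- The John–Nirenberg inequality on cubes. -/
lemma absOsc_le {q p : ℝ} (hq : 1 ≤ q) (hqp : q < p) {Q : Set (Fin n → ℝ)} (hQ : IsCube Q)
    (hf : IntegrableOn f Q) :
    absOsc q f Q ≤ jnConst n q p * (volume Q ^ (-(1 / p)) *
          packingSup (oscWeight p f) Q ^ (1 / p)) := by
  have hp0 : 0 < p := by linarith
  obtain ⟨c, r, hr, hsub, -, hae⟩ := hQ.exists_ball_ae_eq
  rw [absOsc_congr_set hae, measure_congr hae]
  refine (absOsc_ball_le hq hqp hr (hf.mono_set hsub)).trans ?_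
  gcongr
  exact packingSup_mono_set _ hsub

/-! ### Comparison of the suprema with different exponents -/

lemma jnSup_absOsc_le_of_ne_top {p : ℝ≥0∞} (hp : p ≠ ∞) {q α : ℝ} (hq : 1 ≤ q)
    (hqp : q < p.toReal) (hα : 0 ≤ α) {X : Set (Fin n → ℝ)}
    (hf : ∀ Q, IsCube Q → Q ⊆ X → IntegrableOn f Q) :
    jnSup p α X (absOsc q f) ≤ jnConst n q p.toReal * jnSup p α X (absOsc 1 f) := by
  have hs : 0 < p.toReal := by linarith
  have hp0 : p ≠ 0 := fun h => by simp [h] at hs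
  set s := p.toReal with hsdef
  rw [← jnSup_const_mul hp0, jnSup_eq_packingSup hp hp0, jnSup_eq_packingSup hp hp0]
  gcongr ?_ ^ _
  refine packingSup_le_of_le_packingSup fun Q hQ hQX => ?_
  have hQ0 := hQ.volume_ne_zero
  have hQt := hQ.volume_ne_top
  set K := jnConst n q s
  calc volume Q * (volume Q ^ (-α) * absOsc q f Q) ^ s
      ≤ volume Q * (volume Q ^ (-α) * (K * (volume Q ^ (-(1 / s)) *
          packingSup (oscWeight s f) Q ^ (1 / s)))) ^ s := by
        gcongr; exact absOsc_le hq hqp hQ (hf Q hQ hQX)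
    _ = (volume Q * volume Q ^ (-(1 : ℝ))) * ((K * volume Q ^ (-α)) ^ s * packingSup (oscWeight s f) Q) := by
        simp only [ENNReal.mul_rpow_of_nonneg _ _ hs.le, ← ENNReal.rpow_mul]
        rw [one_div_mul_cancel hs.ne', ENNReal.rpow_one,
          show -(1 / s) * s = -1 by field_simp]
        ring
    _ = packingSup (fun R => (K * volume Q ^ (-α)) ^ s * oscWeight s f R) Q := by
        rw [ENNReal.rpow_neg_one, ENNReal.mul_inv_cancel hQ0 hQt, one_mul, mul_packingSup]
    _ ≤ packingSup (fun R => volume R * (volume R ^ (-α) * (K * absOsc 1 f R)) ^ s) Q := by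
        -- As `α ≥ 0`, the factor `|Q|^(-α)` only grows when passed to a subcube `R ⊆ Q`.
        refine packingSup_mono fun R hR hRQ => ?_
        have : volume Q ^ (-α) ≤ volume R ^ (-α) := by
          rw [ENNReal.rpow_neg, ENNReal.rpow_neg, ENNReal.inv_le_inv]
          gcongr
        calc (K * volume Q ^ (-α)) ^ s * oscWeight s f R
            ≤ (K * volume R ^ (-α)) ^ s * oscWeight s f R := by gcongr
          _ = _ := by
            simp only [oscWeight, ENNReal.mul_rpow_of_nonneg _ _ hs.le]
            ring

/-- An auxiliary finite exponent `s > q` suffices: on subcubes of `Q` the oscillation is at most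
`|Q|^α D`, so the packing sum is at most `(|Q|^α D)^s |Q|`. -/
lemma jnSup_absOsc_le_of_top {q s α : ℝ} (hq : 1 ≤ q)
    (hqs : q < s) (hα : 0 ≤ α) {X : Set (Fin n → ℝ)}
    (hf : ∀ Q, IsCube Q → Q ⊆ X → IntegrableOn f Q) :
    jnSup ∞ α X (absOsc q f) ≤ jnConst n q s * jnSup ∞ α X (absOsc 1 f) := by
  have hs : 0 < s := by linarith
  set D := jnSup ∞ α X (absOsc 1 f) with hD
  have hDle : ∀ Q, IsCube Q → Q ⊆ X → volume Q ^ (-α) * absOsc 1 f Q ≤ D := fun Q hQ hQX => by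
    rw [hD, jnSup, if_pos rfl]
    exact le_iSup₂_of_le Q ⟨hQ, hQX⟩ le_rfl
  rw [jnSup, if_pos rfl]
  refine iSup₂_le fun Q ⟨hQ, hQX⟩ => ?_
  have hQ0 := hQ.volume_ne_zero
  have hQt := hQ.volume_ne_top
  have hpack : packingSup (oscWeight s f) Q ≤ (volume Q ^ α * D) ^ s * volume Q := by
    calc packingSup (oscWeight s f) Q ≤ packingSup (fun R => (volume Q ^ α * D) ^ s * volume R) Q := by
          refine packingSup_mono fun R hR hRQ => ?_
          rw [oscWeight, mul_comm]
          gcongr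
          calc absOsc 1 f R = volume R ^ α * (volume R ^ (-α) * absOsc 1 f R) := by
                rw [← mul_assoc, ← ENNReal.rpow_add _ _ hR.volume_ne_zero hR.volume_ne_top]
                simp
            _ ≤ volume Q ^ α * D := by gcongr; exact hDle R hR (hRQ.trans hQX)
      _ = (volume Q ^ α * D) ^ s * packingSup (fun R => volume R) Q := (mul_packingSup _ _ _).symm
      _ ≤ _ := by gcongr; exact packingSup_volume_le Q
  calc volume Q ^ (-α) * absOsc q f Q
      ≤ volume Q ^ (-α) * (jnConst n q s * (volume Q ^ (-(1 / s)) *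
          ((volume Q ^ α * D) ^ s * volume Q) ^ (1 / s))) := by
        gcongr
        refine (absOsc_le hq hqs hQ (hf Q hQ hQX)).trans ?_
        gcongr
    _ = (volume Q ^ (-α) * volume Q ^ α) * (volume Q ^ (-(1 / s)) * volume Q ^ (1 / s)) *
          (jnConst n q s * D) := by
        rw [ENNReal.mul_rpow_of_nonneg _ _ (by positivity), ← ENNReal.rpow_mul,
          mul_one_div_cancel hs.ne', ENNReal.rpow_one]
        ring
    _ = jnConst n q s * D := by
        rw [← ENNReal.rpow_add _ _ hQ0 hQt, ← ENNReal.rpow_add _ _ hQ0 hQt]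
        simp

/-- The John–Nirenberg suprema of `absOsc q` and `absOsc 1` are comparable for `1 ≤ q < p`. -/
lemma exists_jnSup_absOsc_le (n : ℕ) {p : ℝ≥0∞} {q α : ℝ} (hq : 1 ≤ q)
    (hqp : ENNReal.ofReal q < p) (hα : 0 ≤ α) (X : Set (Fin n → ℝ)) :
    ∃ K : ℝ≥0∞, K ≠ ∞ ∧ ∀ f : (Fin n → ℝ) → ℝ, (∀ Q, IsCube Q → Q ⊆ X → IntegrableOn f Q) →
      jnSup p α X (absOsc q f) ≤ K * jnSup p α X (absOsc 1 f) := by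
  have hq0 : 0 < q := by linarith
  by_cases hp : p = ∞
  · subst hp
    exact ⟨jnConst n q (q + 1), jnConst_ne_top hq0 (by linarith), fun f hf =>
      jnSup_absOsc_le_of_top hq (by linarith) hα hf⟩
  · have h : q < p.toReal := (ENNReal.ofReal_lt_iff_lt_toReal hq0.le hp).1 hqp
    exact ⟨jnConst n q p.toReal, jnConst_ne_top hq0 h, fun f hf =>
      jnSup_absOsc_le_of_ne_top hp hq h hα hf⟩

end JNSpace

namespace JNSpace

variable {n : ℕ}

/-! ### The local maximal operator -/

lemma localMaximal_le_add {f g : (Fin n → ℝ) → ℝ} {a : ℝ≥0∞} (h : ∀ y, ‖f y‖ₑ ≤ ‖g y‖ₑ + a)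
    (Q : Set (Fin n → ℝ)) (x : Fin n → ℝ) : localMaximal Q f x ≤ localMaximal Q g x + a := by
  refine iSup₂_le fun R hR => ?_
  have hR0 := hR.1.volume_ne_zero
  have hRt := hR.1.volume_ne_top
  calc (volume R)⁻¹ * ∫⁻ y in R, ‖f y‖ₑ ≤ (volume R)⁻¹ * ∫⁻ y in R, (‖g y‖ₑ + a) := by
        gcongr with y; exact h y
    _ = (volume R)⁻¹ * (∫⁻ y in R, ‖g y‖ₑ) + a := by
        rw [lintegral_add_right _ measurable_const, setLIntegral_const, mul_add, mul_left_comm,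
          ENNReal.inv_mul_cancel hR0 hRt, mul_one]
    _ ≤ _ := by
        gcongr
        exact le_iSup₂_of_le R hR le_rfl

/-- Supplies the bounded radii required by Vitali's covering lemma. In dimension zero every ball is
the whole space and radii are not comparable. -/
lemma radius_le_of_ball_subset_closedBall (hn : n ≠ 0) {c c' : Fin n → ℝ} {r r' : ℝ} (hr : 0 < r)
    (hr' : 0 < r') (h : Metric.ball c r ⊆ Metric.closedBall c' r') : r ≤ r' := by
  have h1 := measure_mono (μ := volume) h
  rw [Real.volume_pi_ball _ hr, Real.volume_pi_closedBall _ hr'.le,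
    ENNReal.ofReal_le_ofReal_iff (by positivity), Fintype.card_fin,
    pow_le_pow_iff_left₀ (by positivity) (by positivity) hn] at h1
  linarith

/-- Weak-type `(1,1)` bound for the local maximal operator. -/
lemma mul_volume_localMaximal_gt_le (hn : n ≠ 0) {Q : Set (Fin n → ℝ)} (hQ : IsCube Q)
    (g : (Fin n → ℝ) → ℝ) (t : ℝ≥0∞) :
    t * volume {x | t < localMaximal Q g x} ≤ 5 ^ n * ∫⁻ x in Q, ‖g x‖ₑ := by
  set S := {x | t < localMaximal Q g x} with hS
  have hex : ∀ x : S, ∃ (c : Fin n → ℝ) (r : ℝ), 0 < r ∧ Metric.ball c r ⊆ Q ∧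
      (x : Fin n → ℝ) ∈ Metric.closedBall c r ∧
      t * volume (Metric.ball c r) ≤ ∫⁻ y in Metric.ball c r, ‖g y‖ₑ := by
    rintro ⟨x, hx⟩
    rw [hS, mem_ofPred, localMaximal, lt_iSup_iff] at hx
    obtain ⟨R, hR⟩ := hx
    obtain ⟨⟨hRc, hxR, hRQ⟩, hlt⟩ := lt_iSup_iff.1 hR
    -- The cube may contain `x` on its boundary, so `x` is only known to lie in the closed ball.
    obtain ⟨c, r, hr, h1, h2, hae⟩ := hRc.exists_ball_ae_eq
    refine ⟨c, r, hr, h1.trans hRQ, h2 hxR, ?_⟩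
    rw [measure_congr hae, Measure.restrict_congr_set hae] at hlt
    calc t * volume (Metric.ball c r)
        ≤ (volume (Metric.ball c r))⁻¹ * (∫⁻ y in Metric.ball c r, ‖g y‖ₑ) *
            volume (Metric.ball c r) := by gcongr
      _ = _ := by
        rw [mul_right_comm, ENNReal.inv_mul_cancel (volume_ball_ne_zero c hr)
          (volume_ball_ne_top c r), one_mul]
  choose c r hr hcQ hxc ht using hex
  obtain ⟨c₀, r₀, hr₀, -, hQ₀⟩ := hQ.exists_ball
  obtain ⟨u, -, hud, hu⟩ := Vitali.exists_disjoint_subfamily_covering_enlargement_closedBall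
    (univ : Set S) c r r₀
    (fun x _ => radius_le_of_ball_subset_closedBall hn (hr x) hr₀ ((hcQ x).trans hQ₀)) 5 (by norm_num)
  have hud' : u.PairwiseDisjoint fun x => Metric.ball (c x) (r x) :=
    hud.mono fun x => Metric.ball_subset_closedBall
  have huc : u.Countable := hud'.countable_of_isOpen (fun _ _ => Metric.isOpen_ball)
    fun x _ => ⟨c x, Metric.mem_ball_self (hr x)⟩
  have hcov : S ⊆ ⋃ b ∈ u, Metric.closedBall (c b) (5 * r b) := fun x hx => by
    obtain ⟨b, hb, hsub⟩ := hu ⟨x, hx⟩ (mem_univ _)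
    exact mem_biUnion hb (hsub (hxc ⟨x, hx⟩))
  have hvol : ∀ b, volume (Metric.closedBall (c b) (5 * r b)) =
      5 ^ n * volume (Metric.ball (c b) (r b)) := fun b => by
    have hb := hr b
    rw [Real.volume_pi_ball _ hb, Real.volume_pi_closedBall _ (by positivity), Fintype.card_fin,
      ← ENNReal.ofReal_ofNat 5, ← ENNReal.ofReal_pow (by norm_num),
      ← ENNReal.ofReal_mul (by positivity), ← mul_pow]
    congr 2
    ring
  calc t * volume S ≤ t * ∑' b : u, volume (Metric.closedBall (c b) (5 * r b)) := by
        gcongr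
        exact (measure_mono hcov).trans (measure_biUnion_le _ huc _)
    _ = 5 ^ n * ∑' b : u, t * volume (Metric.ball (c b) (r b)) := by
        simp only [hvol, ENNReal.tsum_mul_left]
        ring
    _ ≤ 5 ^ n * ∑' b : u, ∫⁻ y in Metric.ball (c b) (r b), ‖g y‖ₑ := by
        gcongr with b
        exact ht b
    _ = 5 ^ n * ∫⁻ y in ⋃ b ∈ u, Metric.ball (c b) (r b), ‖g y‖ₑ := by
        rw [lintegral_biUnion huc (fun _ _ => measurableSet_ball) hud']
    _ ≤ _ := by
        gcongr
        exact iUnion₂_subset fun b _ => hcQ b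

/-- Truncated weak-type bound: only the part of `g` above `t / 2` contributes. -/
lemma mul_volume_localMaximal_gt_le_withDensity (hn : n ≠ 0) {Q : Set (Fin n → ℝ)}
    (hQ : IsCube Q) (g : (Fin n → ℝ) → ℝ) {t : ℝ} (ht : 0 < t) :
    ENNReal.ofReal (t / 2) * volume {x | ENNReal.ofReal t < localMaximal Q g x} ≤
      5 ^ n * (volume.restrict Q).withDensity (fun x => ‖g x‖ₑ) {x | t < 2 * |g x|} := by
  set s := {x | t < 2 * |g x|} with hs
  set g₁ : (Fin n → ℝ) → ℝ := s.indicator g with hg₁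
  have hle : ∀ y, ‖g y‖ₑ ≤ ‖g₁ y‖ₑ + ENNReal.ofReal (t / 2) := fun y => by
    by_cases hy : y ∈ s
    · rw [hg₁, indicator_of_mem hy]; exact le_self_add
    · have : |g y| ≤ t / 2 := by
        have : ¬ t < 2 * |g y| := hy
        linarith
      rw [Real.enorm_eq_ofReal_abs]
      exact (ENNReal.ofReal_le_ofReal this).trans le_add_self
  have hsub : {x | ENNReal.ofReal t < localMaximal Q g x} ⊆
      {x | ENNReal.ofReal (t / 2) < localMaximal Q g₁ x} := fun x hx => by
    by_contra hcon
    have h1 : localMaximal Q g₁ x ≤ ENNReal.ofReal (t / 2) := not_lt.1 hcon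
    refine (not_le.2 (mem_ofPred.1 hx)) ?_
    calc localMaximal Q g x ≤ localMaximal Q g₁ x + ENNReal.ofReal (t / 2) :=
          localMaximal_le_add hle Q x
      _ ≤ ENNReal.ofReal (t / 2) + ENNReal.ofReal (t / 2) := by gcongr
      _ = ENNReal.ofReal t := by
          rw [← ENNReal.ofReal_add (by positivity) (by positivity), add_halves]
  calc _ ≤ ENNReal.ofReal (t / 2) * volume {x | ENNReal.ofReal (t / 2) < localMaximal Q g₁ x} := by
        gcongr
    _ ≤ 5 ^ n * ∫⁻ x in Q, ‖g₁ x‖ₑ := mul_volume_localMaximal_gt_le hn hQ g₁ _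
    _ ≤ _ := by
        gcongr
        rw [withDensity_apply']
        have : ∀ x, ‖g₁ x‖ₑ = s.indicator (fun x => ‖g x‖ₑ) x := fun x =>
          enorm_indicator_eq_indicator_enorm _ _
        simp only [this]
        exact lintegral_indicator_le _ _

/-- Constant of the strong-type bound for the local maximal operator. -/
noncomputable def maximalConst (n : ℕ) (q : ℝ) : ℝ≥0∞ :=
  ENNReal.ofReal q * (2 * 5 ^ n * ((ENNReal.ofReal (q - 1))⁻¹ * 2 ^ (q - 1)))

lemma maximalConst_ne_top {q : ℝ} (hq : 1 < q) : maximalConst n q ≠ ∞ := by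
  have h1 : (ENNReal.ofReal (q - 1))⁻¹ ≠ ∞ := by simpa using hq
  have h2 : (2 : ℝ≥0∞) ^ (q - 1) ≠ ∞ := ENNReal.rpow_ne_top_of_nonneg (by linarith) (by simp)
  unfold maximalConst
  finiteness

/-- Strong-type `(q,q)` bound for the local maximal operator. -/
lemma lintegral_localMaximal_rpow_le (hn : n ≠ 0) {q : ℝ} (hq : 1 < q) {Q : Set (Fin n → ℝ)}
    (hQ : IsCube Q) {g : (Fin n → ℝ) → ℝ} (hg : AEStronglyMeasurable g (volume.restrict Q)) :
    ∫⁻ x in Q, localMaximal Q g x ^ q ≤ maximalConst n q * ∫⁻ x in Q, ‖g x‖ₑ ^ q := by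
  have hq0 : 0 < q := by linarith
  have hq1 : 0 < q - 1 := by linarith
  set ν := (volume.restrict Q).withDensity (fun x => ‖g x‖ₑ) with hν
  have hgm : AEMeasurable (fun x => 2 * |g x|) ν :=
    (((continuous_abs.measurable.comp_aemeasurable hg.aemeasurable).const_mul 2)).mono_ac
      (withDensity_absolutelyContinuous _ _)
  -- Layer cake for `2|g|` at exponent `q - 1` with respect to `|g| dx`; the density supplies the
  -- missing power.
  have hJ : ENNReal.ofReal (q - 1) *
      ∫⁻ t in Ioi (0 : ℝ), ν {x | t < 2 * |g x|} * ENNReal.ofReal (t ^ (q - 1 - 1)) =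
      2 ^ (q - 1) * ∫⁻ x in Q, ‖g x‖ₑ ^ q := by
    rw [← lintegral_rpow_eq_lintegral_meas_lt_mul ν
      (Filter.Eventually.of_forall fun x => by positivity) hgm hq1, hν,
      lintegral_withDensity_eq_lintegral_mul₀' hg.aemeasurable.enorm
        ((hgm.pow_const _).ennreal_ofReal), ← lintegral_const_mul' _ _
        (ENNReal.rpow_ne_top_of_nonneg hq1.le (by simp))]
    refine lintegral_congr fun x => ?_
    rw [Pi.mul_apply, ← ENNReal.ofReal_rpow_of_nonneg (by positivity) hq1.le,
      ENNReal.ofReal_mul (by norm_num), ENNReal.ofReal_ofNat, ← Real.enorm_eq_ofReal_abs,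
      ENNReal.mul_rpow_of_nonneg _ _ hq1.le, mul_left_comm]
    congr 1
    nth_rewrite 1 [← ENNReal.rpow_one ‖g x‖ₑ]
    rw [← ENNReal.rpow_add_of_nonneg _ _ zero_le_one hq1.le]
    congr 1
    ring
  have hJ' : ∫⁻ t in Ioi (0 : ℝ), ν {x | t < 2 * |g x|} * ENNReal.ofReal (t ^ (q - 1 - 1)) =
      (ENNReal.ofReal (q - 1))⁻¹ * 2 ^ (q - 1) * ∫⁻ x in Q, ‖g x‖ₑ ^ q := by
    rw [mul_assoc, ← hJ, ← mul_assoc, ENNReal.inv_mul_cancel (by simpa using hq) (by simp), one_mul]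
  -- Measurability of the maximal function is avoided: layer cake is applied to `φ^(1/q)` for each
  -- simple function `φ` below its `q`-th power.
  rw [lintegral_eq_nnreal]
  refine iSup₂_le fun φ hφ => ?_
  rw [← SimpleFunc.lintegral_eq_lintegral]
  set h : (Fin n → ℝ) → ℝ := fun x => (φ x : ℝ) ^ (1 / q) with hh
  have hhM : ∀ x, ENNReal.ofReal (h x) ≤ localMaximal Q g x := fun x => by
    rw [hh]
    simp only
    rw [← ENNReal.ofReal_rpow_of_nonneg (by positivity) (by positivity), ENNReal.ofReal_coe_nnreal]
    calc ((φ x : ℝ≥0) : ℝ≥0∞) ^ (1 / q) ≤ (localMaximal Q g x ^ q) ^ (1 / q) := by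
          gcongr; exact hφ x
      _ = _ := by rw [← ENNReal.rpow_mul, mul_one_div_cancel hq0.ne', ENNReal.rpow_one]
  have hhq : ∀ x, SimpleFunc.map ENNReal.ofNNReal φ x = ENNReal.ofReal (h x ^ q) := fun x => by
    rw [SimpleFunc.map_apply, hh]
    simp only
    rw [← Real.rpow_mul (by positivity), one_div_mul_cancel hq0.ne', Real.rpow_one,
      ENNReal.ofReal_coe_nnreal]
  have hhm : AEMeasurable h (volume.restrict Q) :=
    (φ.measurable.coe_nnreal_real.pow_const _).aemeasurable
  simp only [hhq]
  rw [lintegral_rpow_eq_lintegral_meas_lt_mul _ (Filter.Eventually.of_forall fun x => by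
    simp only [hh]; positivity) hhm hq0, maximalConst, mul_assoc, mul_assoc (2 * 5 ^ n), ← hJ',
    ← lintegral_const_mul' (2 * 5 ^ n) _ (by finiteness)]
  gcongr ENNReal.ofReal q * ?_
  refine setLIntegral_mono' measurableSet_Ioi fun t ht => ?_
  have ht0 : 0 < t := ht
  have e : ENNReal.ofReal (t ^ (q - 1)) =
      2 * (ENNReal.ofReal (t / 2) * ENNReal.ofReal (t ^ (q - 1 - 1))) := by
    rw [← ENNReal.ofReal_ofNat 2, ← ENNReal.ofReal_mul (by positivity),
      ← ENNReal.ofReal_mul (by positivity)]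
    congr 1
    rw [Real.rpow_sub_one ht0.ne' (q - 1)]
    field_simp
  have hle : (volume.restrict Q) {a | t < h a} ≤
      volume {x | ENNReal.ofReal t < localMaximal Q g x} := by
    refine (Measure.restrict_apply_le _ _).trans (measure_mono fun x hx => ?_)
    exact ((ENNReal.ofReal_lt_ofReal_iff (ht0.trans hx)).2 hx).trans_le (hhM x)
  calc (volume.restrict Q) {a | t < h a} * ENNReal.ofReal (t ^ (q - 1))
      ≤ volume {x | ENNReal.ofReal t < localMaximal Q g x} * ENNReal.ofReal (t ^ (q - 1)) := by
        gcongr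
    _ = 2 * (ENNReal.ofReal (t / 2) * volume {x | ENNReal.ofReal t < localMaximal Q g x}) *
          ENNReal.ofReal (t ^ (q - 1 - 1)) := by rw [e]; ring
    _ ≤ 2 * (5 ^ n * ν {x | t < 2 * |g x|}) * ENNReal.ofReal (t ^ (q - 1 - 1)) := by
        gcongr 2 * ?_ * _
        exact mul_volume_localMaximal_gt_le_withDensity hn hQ g ht0
    _ = _ := by ring

/-- Constant of the comparison `maxOsc q ≤ C * absOsc q`. -/
noncomputable def maxOscConst (n : ℕ) (q : ℝ) : ℝ≥0∞ :=
  (2 ^ (q - 1) * (1 + maximalConst n q)) ^ (1 / q)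

lemma maxOscConst_ne_top {q : ℝ} (hq : 1 < q) : maxOscConst n q ≠ ∞ := by
  have h1 : (2 : ℝ≥0∞) ^ (q - 1) ≠ ∞ := ENNReal.rpow_ne_top_of_nonneg (by linarith) (by simp)
  have h2 := maximalConst_ne_top (n := n) hq
  refine ENNReal.rpow_ne_top_of_nonneg (one_div_nonneg.2 (by linarith)) ?_
  finiteness

lemma maxOsc_le_absOsc (hn : n ≠ 0) {q : ℝ} (hq : 1 < q) {Q : Set (Fin n → ℝ)} (hQ : IsCube Q)
    {f : (Fin n → ℝ) → ℝ} (hf : IntegrableOn f Q) :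
    maxOsc q f Q ≤ maxOscConst n q * absOsc q f Q := by
  have hq0 : 0 < q := by linarith
  set c := ⨍ y in Q, |f y| with hc
  have hc0 : 0 ≤ c := setAverage_abs_nonneg f Q
  set g : (Fin n → ℝ) → ℝ := fun x => f x - c with hg
  have hgm : AEStronglyMeasurable g (volume.restrict Q) := hf.1.sub aestronglyMeasurable_const
  have hM : ∀ x, localMaximal Q f x ≤ localMaximal Q g x + ENNReal.ofReal c := fun x => by
    refine localMaximal_le_add (fun y => ?_) Q x
    rw [← Real.enorm_eq_ofReal hc0]
    calc ‖f y‖ₑ = ‖g y + c‖ₑ := by simp [hg]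
      _ ≤ _ := enorm_add_le _ _
  have hint : ∫⁻ x in Q, EReal.abs ((f x : EReal) - (localMaximal Q f x : EReal)) ^ q ≤
      2 ^ (q - 1) * (1 + maximalConst n q) * ∫⁻ x in Q, ‖g x‖ₑ ^ q := by
    calc _ ≤ ∫⁻ x in Q, 2 ^ (q - 1) * (‖g x‖ₑ ^ q + localMaximal Q g x ^ q) := by
          refine setLIntegral_mono' hQ.measurableSet fun x hx => ?_
          refine le_trans ?_ (ENNReal.rpow_add_le_mul_rpow_add_rpow _ _ hq.le)
          gcongr
          refine (abs_coe_sub_coe_le (ofReal_setAverage_abs_le_localMaximal hQ hf hx) hc0).trans ?_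
          gcongr
          exact tsub_le_iff_right.2 (hM x)
      _ = 2 ^ (q - 1) * ((∫⁻ x in Q, ‖g x‖ₑ ^ q) + ∫⁻ x in Q, localMaximal Q g x ^ q) := by
          rw [lintegral_const_mul' _ _ (ENNReal.rpow_ne_top_of_nonneg (by linarith) (by simp)),
            lintegral_add_left' (hgm.aemeasurable.enorm.pow_const q)]
      _ ≤ 2 ^ (q - 1) * ((∫⁻ x in Q, ‖g x‖ₑ ^ q) + maximalConst n q * ∫⁻ x in Q, ‖g x‖ₑ ^ q) := by
          gcongr
          exact lintegral_localMaximal_rpow_le hn hq hQ hgm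
      _ = _ := by ring
  rw [maxOsc, absOsc, lqMean, lqMean, maxOscConst, ← ENNReal.mul_rpow_of_nonneg _ _ (by positivity)]
  gcongr ?_ ^ _
  exact (mul_le_mul' le_rfl hint).trans (le_of_eq (mul_left_comm _ _ _))

/-! ### Proof of the equivalence -/

lemma MemLqLoc.integrableOn {q : ℝ} (hq : 1 ≤ q) {X : Set (Fin n → ℝ)} {f : (Fin n → ℝ) → ℝ}
    (hf : MemLqLoc q X f) {Q : Set (Fin n → ℝ)} (hQ : IsCube Q) (hQX : Q ⊆ X) :
    IntegrableOn f Q := by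
  have : IsFiniteMeasure (volume.restrict Q) := ⟨by simpa using hQ.volume_ne_top.lt_top⟩
  exact (hf.2 Q hQX hQ.measurableSet hQ.isBounded).integrable (by simpa using hq)

lemma exists_jnTildeNorm_le (n : ℕ) {p : ℝ≥0∞} {q α : ℝ} (hq : 1 ≤ q)
    (hqp : ENNReal.ofReal q < p) (hα : 0 ≤ α) (X : Set (Fin n → ℝ)) :
    ∃ K : ℝ≥0∞, K ≠ ∞ ∧ ∀ f : (Fin n → ℝ) → ℝ, MemLqLoc q X f →
      jnTildeNorm p q α X f ≤ K * jnMaximalNorm p q α X f := by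
  have hp0 : p ≠ 0 := (zero_le.trans_lt hqp).ne'
  obtain ⟨K, hK, h⟩ := exists_jnSup_absOsc_le n hq hqp hα X
  refine ⟨K * 2, by finiteness, fun f hf => ?_⟩
  calc jnTildeNorm p q α X f ≤ K * jnSup p α X (absOsc 1 f) :=
        h f fun Q hQ hQX => hf.integrableOn hq hQ hQX
    _ ≤ K * jnSup p α X (fun Q => 2 * maxOsc q f Q) := by
        gcongr
        refine jnSup_mono hp0 fun Q hQ hQX => ?_
        refine (absOsc_one_le_maxOsc_one hQ (hf.integrableOn hq hQ hQX)).trans ?_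
        gcongr
        exact lqMean_le_lqMean one_pos hq hQ.volume_ne_zero hQ.volume_ne_top _
    _ = K * 2 * jnMaximalNorm p q α X f := by rw [jnSup_const_mul hp0, mul_assoc]; rfl

lemma exists_jnMaximalNorm_le (hn : n ≠ 0) {p : ℝ≥0∞} {q α : ℝ} (hq : 1 ≤ q)
    (hqp : ENNReal.ofReal q < p) (hα : 0 ≤ α) (X : Set (Fin n → ℝ)) :
    ∃ K : ℝ≥0∞, K ≠ ∞ ∧ ∀ f : (Fin n → ℝ) → ℝ, MemLqLoc q X f →
      jnMaximalNorm p q α X f ≤ K * jnTildeNorm p q α X f := by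
  have hq0 : 0 < q := by linarith
  have hp0 : p ≠ 0 := (zero_le.trans_lt hqp).ne'
  -- The room between `q` and `p` gives `s > 1` even when `q = 1`, where the strong-type maximal
  -- bound is unavailable.
  obtain ⟨s', hqs', hsp'⟩ := exists_between hqp
  obtain ⟨s, rfl⟩ : ∃ s, s' = ENNReal.ofReal s := ⟨_, (ENNReal.ofReal_toReal hsp'.ne_top).symm⟩
  have hqs : q < s := (ENNReal.ofReal_lt_ofReal_iff_of_nonneg hq0.le).1 hqs'
  have hs1 : 1 < s := by linarith
  obtain ⟨K, hK, h⟩ := exists_jnSup_absOsc_le n hs1.le hsp' hα X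
  refine ⟨maxOscConst n s * K, ENNReal.mul_ne_top (maxOscConst_ne_top hs1) hK, fun f hf => ?_⟩
  have hfi := fun Q hQ hQX => hf.integrableOn hq (Q := Q) hQ hQX
  calc jnMaximalNorm p q α X f ≤ jnSup p α X (fun Q => maxOscConst n s * absOsc s f Q) := by
        refine jnSup_mono hp0 fun Q hQ hQX => ?_
        exact (lqMean_le_lqMean hq0 hqs.le hQ.volume_ne_zero hQ.volume_ne_top _).trans
          (maxOsc_le_absOsc hn hs1 hQ (hfi Q hQ hQX))
    _ = maxOscConst n s * jnSup p α X (absOsc s f) := jnSup_const_mul hp0 _ _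
    _ ≤ maxOscConst n s * (K * jnSup p α X (absOsc 1 f)) := by
        gcongr
        exact h f hfi
    _ ≤ maxOscConst n s * (K * jnTildeNorm p q α X f) := by
        gcongr
        exact jnSup_mono hp0 fun Q hQ _ =>
          lqMean_le_lqMean one_pos hq hQ.volume_ne_zero hQ.volume_ne_top _
    _ = _ := (mul_assoc _ _ _).symm

end JNSpace

theorem mainTheorem2 {n : ℕ} (hn : 1 ≤ n) (p : ENNReal) (q α : ℝ) (hq : 1 ≤ q)
    (hqp : ENNReal.ofReal q < p) (hα : 0 ≤ α)
    (X : Set (Fin n → ℝ)) (hX : X = Set.univ ∨ JNSpace.IsCube X) :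
    (∀ f : (Fin n → ℝ) → ℝ,
      JNSpace.MemJNTilde p q α X f ↔
        (JNSpace.MemLqLoc q X f ∧ JNSpace.jnMaximalNorm p q α X f < ⊤)) ∧
    ∃ C : NNReal, 0 < C ∧ ∀ f : (Fin n → ℝ) → ℝ, JNSpace.MemLqLoc q X f →
      JNSpace.jnTildeNorm p q α X f ≤ C * JNSpace.jnMaximalNorm p q α X f ∧
      JNSpace.jnMaximalNorm p q α X f ≤ C * JNSpace.jnTildeNorm p q α X f := by
  obtain ⟨K₁, hK₁, h₁⟩ := JNSpace.exists_jnTildeNorm_le n hq hqp hα X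
  obtain ⟨K₂, hK₂, h₂⟩ := JNSpace.exists_jnMaximalNorm_le (by omega : n ≠ 0) hq hqp hα X
  refine ⟨fun f => and_congr_right fun hf => ⟨fun h => ?_, fun h => ?_⟩,
    K₁.toNNReal + K₂.toNNReal + 1, by positivity, fun f hf => ⟨?_, ?_⟩⟩
  · exact (h₂ f hf).trans_lt (ENNReal.mul_lt_top hK₂.lt_top h)
  · exact (h₁ f hf).trans_lt (ENNReal.mul_lt_top hK₁.lt_top h)
  · refine (h₁ f hf).trans ?_
    gcongr
    push_cast
    rw [ENNReal.coe_toNNReal hK₁, add_assoc]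
    exact le_self_add
  · refine (h₂ f hf).trans ?_
    gcongr
    push_cast
    rw [ENNReal.coe_toNNReal hK₂, add_right_comm]
    exact le_add_self
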